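/- Let $n \ge 0$ and let $\Sigma$ be a complete fan in $\mathbb{R}^n$, i.e. a finite collection of strongly convex polyhedral cones, closed under passing to faces, any two of which intersect in a common face, with union $\mathbb{R}^n$. Let $S^{n-1} \subset B^n$ be the unit sphere and the closed unit ball. Intersecting the cones of $\Sigma$ with $S^{n-1}$ gives a spherical complex $C_\Sigma$; let $C'_\Sigma$ be a barycentric subdivision of it: for every cone $\tau \ne \{0\}$ of $\Sigma$ choose a point $b_\tau \in S^{n-1}$ in the relative interior of $\tau$ (the barycenter of $\tau \cap S^{n-1}$); the simplices of $C'_\Sigma$ are the spherical simplices $S^{n-1} \cap \mathrm{cone}(b_{\tau_0}, \dots, b_{\tau_r})$ for the chains $\{0\} \ne \tau_0 \subsetneq \dots \subsetneq \tau_r$ in $\Sigma$. The spherical dual of $\sigma \in \Sigma$ is $\widehat{\sigma} := B^n$ if $\sigma = \{0\}$, and otherwise the union $\widehat{\sigma}$ of all simplices of $C'_\Sigma$ all of whose vertices are barycenters $b_\tau$ with $\sigma \subset \tau \in \Sigma$. Put $Q_i := \bigcup \{\widehat{\sigma} \mid \sigma \in \Sigma,\ \mathrm{codim}(\sigma) =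 i\}$ for $i \le n$ (so $Q_i=\emptyset$ for $i<0$). Then, for every such choice of barycenters, $B^n = Q_n \supset Q_{n-1} \supset \dots \supset Q_0 \supset \emptyset$ makes $B^n$ an $n$-dimensional topological stratified pseudomanifold. Here a topological stratified pseudomanifold of dimension $d$ is defined inductively as a Hausdorff space $Q$ with a filtration $Q = Q_d \supset Q_{d-1} \supset \dots \supset Q_0 \supset Q_{-1} = \emptyset$ such that: if $d = 0$, then $Q$ is discrete; if $d > 0$, then the $Q_i$ are closed, $Q_{d-1} \ne Q$, and (1) for $0 \le k \le d$ every connected component of $Q_k \setminus Q_{k-1}$ is a $k$-dimensional topological manifold; (2) $Q_d \setminus Q_{d-1}$ is dense in $Q$; (3) for $0 \le k \le d$ and each $p \in Q_k \setminus Q_{k-1}$ there are an open neighborhood $U$ of $p$ in $Q$, a contractible open set $O \subset \mathbb{R}^k$, a compact topological stratified pseudomanifold $L$ of dimension $d-k-1$ (the empty space if $k = d$), and a homeomorphism $\varphi : U \to O \times \mathring{c}(L)$ that maps $U \cap Q_{k+j+1}$ onto $O \times \mathring{c}(L_j)$ for all $-1 \le j \le d-k-1$, where $\mathring{c}(L)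 = L \times [0,1) / L \times \{0\}$ is the open cone, $\mathring{c}(\emptyset)$ is a point and $\mathring{c}(L_j)$ is regarded as a subset of $\mathring{c}(L)$. -/

import Mathlib

open Set

universe u

/-! ### Open cones -/

/-- The relation collapsing `L × {0}` to a point. An extra point is adjoined first and glued to
`L × {0}`, so that for nonempty `L` one gets the quotient `L × [0,1) / L × {0}` and for empty `L`
one gets a single point. -/
inductive ConeRel (L : Type u) :
    (L × Ico (0 : ℝ) 1) ⊕ PUnit.{1} → (L × Ico (0 : ℝ) 1) ⊕ PUnit.{1} → Prop
  | collapse (x : L) (t : Ico (0 : ℝ) 1) (ht : (t : ℝ) = 0) :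
      ConeRel L (Sum.inl (x, t)) (Sum.inr PUnit.unit)

/-- The open cone `c(L) = L × [0,1) / L × {0}`; the open cone on the empty space is a point. -/
def OpenCone (L : Type u) : Type u := Quot (ConeRel L)

/-- The quotient topology on the open cone. -/
instance OpenCone.instTopologicalSpace (L : Type u) [TopologicalSpace L] :
    TopologicalSpace (OpenCone L) :=
  inferInstanceAs (TopologicalSpace (Quot (ConeRel L)))

/-- The cone vertex. -/
def OpenCone.vertex (L : Type u) : OpenCone L := Quot.mk _ (Sum.inr PUnit.unit)

/-- The point `[x, t]` of the open cone. -/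
def OpenCone.mk {L : Type u} (x : L) (t : Ico (0 : ℝ) 1) : OpenCone L :=
  Quot.mk _ (Sum.inl (x, t))

/-- The open cone on a subset `A` of `L`, as a subset of the open cone on `L`. It always contains
the vertex; in particular the subcone on `∅` is the vertex. -/
def OpenCone.subcone {L : Type u} (A : Set L) : Set (OpenCone L) :=
  {z | z = OpenCone.vertex L ∨ ∃ x ∈ A, ∃ t : Ico (0 : ℝ) 1, z = OpenCone.mk x t}

/-! ### Topological stratified pseudomanifolds -/

/-- `C` is a topological manifold of dimension `k` (without boundary): Hausdorff, second countable
and locally homeomorphic to `ℝ^k`. -/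
def IsTopologicalManifold (k : ℕ) (C : Type u) [TopologicalSpace C] : Prop :=
  T2Space C ∧ SecondCountableTopology C ∧ Nonempty (ChartedSpace (EuclideanSpace ℝ (Fin k)) C)

/-- `(X, F)` is a `d`-dimensional topological stratified pseudomanifold, where `F i` is the
`i`-skeleton for `i ≤ d` (negative skeleta are empty; the values `F i` for `i > d` play no role).
A link of a point of the `k`-dimensional part `F k \ F (k - 1)` has dimension `d - k - 1`; for
`k = d` this is `-1`, which means that the link is empty. -/
def IsTopologicalStratifiedPseudomanifold (d : ℕ) (X : Type u) [TopologicalSpace X]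
    (F : ℤ → Set X) : Prop :=
  T2Space X ∧
  (∀ i : ℤ, i < 0 → F i = ∅) ∧
  F d = univ ∧
  (d = 0 → DiscreteTopology X) ∧
  (d ≠ 0 →
    -- a filtration by closed subsets, with proper `(d - 1)`-skeleton
    (∀ i : ℤ, i ≤ d → IsClosed (F i)) ∧
    (∀ i j : ℤ, i ≤ j → j ≤ d → F i ⊆ F j) ∧
    F (d - 1) ≠ univ ∧
    -- the connected components of `F k \ F (k - 1)` are `k`-dimensional manifolds
    (∀ k : ℕ, k ≤ d → ∀ x ∈ F k \ F (k - 1),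
      IsTopologicalManifold k (connectedComponentIn (F k \ F (k - 1)) x)) ∧
    -- the top strata are dense
    Dense (F d \ F (d - 1)) ∧
    -- local cone structure
    (∀ k : ℕ, k ≤ d → ∀ p ∈ F k \ F (k - 1),
      ∃ (U : Set X) (O : Set (EuclideanSpace ℝ (Fin k)))
        (L : Type u) (_ : TopologicalSpace L) (_ : CompactSpace L) (_ : T2Space L)
        (G : ℤ → Set L) (φ : U ≃ₜ O × OpenCone L),
        IsOpen U ∧ p ∈ U ∧ IsOpen O ∧ ContractibleSpace O ∧
        ((k = d ∧ IsEmpty L) ∨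
          ∃ (e : ℕ) (_ : e + k + 1 = d), IsTopologicalStratifiedPseudomanifold e L G) ∧
        -- `φ` maps `U ∩ F (k + j + 1)` onto `O × c(G j)`
        ∀ j : ℤ, -1 ≤ j → j ≤ d - k - 1 → ∀ q : U,
          (q : X) ∈ F (k + j + 1) ↔ (φ q).2 ∈ OpenCone.subcone (G j)))
termination_by d
decreasing_by omega

/-! ### Fans and spherical duals -/

/-- The dimension of a cone: the dimension of its linear span. -/
noncomputable def coneDim {n : ℕ} (σ : PointedCone ℝ (EuclideanSpace ℝ (Fin n))) : ℕ :=
  Module.finrank ℝ (Submodule.span ℝ (σ : Set (EuclideanSpace ℝ (Fin n))))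

/-- A complete fan in `ℝ^n`: a finite collection of strongly convex polyhedral cones, closed under
faces, any two of which meet in a common face, and whose union is `ℝ^n`. -/
structure IsCompleteFan {n : ℕ} (S : Set (PointedCone ℝ (EuclideanSpace ℝ (Fin n)))) : Prop where
  finite : S.Finite
  polyhedral : ∀ σ ∈ S, σ.FG
  stronglyConvex : ∀ σ ∈ S, (σ : ConvexCone ℝ (EuclideanSpace ℝ (Fin n))).Salient
  face_mem : ∀ σ ∈ S, ∀ τ : PointedCone ℝ (EuclideanSpace ℝ (Fin n)), τ.IsFaceOf σ → τ ∈ S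
  inter_isFace : ∀ σ ∈ S, ∀ τ ∈ S, (σ ⊓ τ).IsFaceOf σ ∧ (σ ⊓ τ).IsFaceOf τ
  complete : ∀ x : EuclideanSpace ℝ (Fin n), ∃ σ ∈ S, x ∈ σ

/-- `b` chooses, for every nonzero cone `σ` of the fan, a barycenter of the spherical cell
`σ ∩ S^{n-1}`, i.e. a point of the unit sphere in the relative interior of `σ`. -/
def IsBarycenterChoice {n : ℕ} (S : Set (PointedCone ℝ (EuclideanSpace ℝ (Fin n))))
    (b : PointedCone ℝ (EuclideanSpace ℝ (Fin n)) → EuclideanSpace ℝ (Fin n)) : Prop :=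
  ∀ σ ∈ S, σ ≠ ⊥ → b σ ∈ Metric.sphere (0 : EuclideanSpace ℝ (Fin n)) 1 ∧
    b σ ∈ intrinsicInterior ℝ (σ : Set (EuclideanSpace ℝ (Fin n)))

/-- A flag of the spherical complex of the fan `S`: a nonempty chain of nonzero cones of `S`. -/
def IsSphericalFlag {n : ℕ} (S c : Set (PointedCone ℝ (EuclideanSpace ℝ (Fin n)))) : Prop :=
  c.Nonempty ∧ c ⊆ S ∧ ⊥ ∉ c ∧ IsChain (· ≤ ·) c

/-- The simplex of the barycentric subdivision belonging to a flag `c`: the spherical simplex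
whose vertices are the barycenters `b τ`, `τ ∈ c`. -/
def barycentricSimplex {n : ℕ}
    (b : PointedCone ℝ (EuclideanSpace ℝ (Fin n)) → EuclideanSpace ℝ (Fin n))
    (c : Set (PointedCone ℝ (EuclideanSpace ℝ (Fin n)))) : Set (EuclideanSpace ℝ (Fin n)) :=
  Metric.sphere 0 1 ∩ (PointedCone.hull ℝ (b '' c) : Set (EuclideanSpace ℝ (Fin n)))

open scoped Classical in
/-- The spherical dual of a cone `σ` of the fan `S`: the whole closed unit ball if `σ = {0}`, and
otherwise the union of the simplices of the barycentric subdivision all of whose vertices are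
barycenters of cones `τ` of `S` containing `σ`. -/
noncomputable def sphericalDual {n : ℕ} (S : Set (PointedCone ℝ (EuclideanSpace ℝ (Fin n))))
    (b : PointedCone ℝ (EuclideanSpace ℝ (Fin n)) → EuclideanSpace ℝ (Fin n))
    (σ : PointedCone ℝ (EuclideanSpace ℝ (Fin n))) : Set (EuclideanSpace ℝ (Fin n)) :=
  if σ = ⊥ then Metric.closedBall 0 1
  else ⋃₀ {θ | ∃ c, IsSphericalFlag S c ∧ (∀ τ ∈ c, σ ≤ τ) ∧ θ = barycentricSimplex b c}

/-- The filtration of the closed unit ball of `ℝ^n`: the `i`-skeleton is the union of the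
spherical duals of the cones of codimension `i`. -/
def ballFiltration {n : ℕ} (S : Set (PointedCone ℝ (EuclideanSpace ℝ (Fin n))))
    (b : PointedCone ℝ (EuclideanSpace ℝ (Fin n)) → EuclideanSpace ℝ (Fin n)) (i : ℤ) :
    Set (Metric.closedBall (0 : EuclideanSpace ℝ (Fin n)) 1) :=
  {x | ∃ σ ∈ S, (n : ℤ) - coneDim σ = i ∧ (x : EuclideanSpace ℝ (Fin n)) ∈ sphericalDual S b σ}

/-! ### Linear maps on closed cones -/

section ClosedCone

variable {E V : Type*} [NormedAddCommGroup E] [NormedSpace ℝ E] [FiniteDimensional ℝ E]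
  [NormedAddCommGroup V] [NormedSpace ℝ V]

/-! The cones over the simplices of the barycentric subdivision triangulate `ℝ^n`: every vector is a
unique nonnegative combination of barycenters `b τ` whose support is a chain of nonzero cones. These
coordinates (`chainCoord`) are continuous, because the summation map on the closed cone of
admissible coefficients is proper. In coordinates the filtration becomes simple: for `i < n`, a
point lies in `Q_i` iff it has norm 1 and every cone in its support has dimension at least `n - i`
(`ballFiltration_eq_dualFiltration`).

The geometry is then forgotten in favour of `IsConicalTriangulation`, which keeps unique chain
coordinates together with the fact that a large multiple of `b σ` absorbs any vector of the span of
`σ`. For `dim σ = e + 1` and `k = n - dim σ`, the elements below `σ`, projected along `b σ`, again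
form such a triangulation of `ℝ^e` (`IsConicalTriangulation.link`). The elements above `σ`,
projected modulo the span of `σ`, give unique chain coordinates on `ℝ^k`
(`IsConicalTriangulation.bijOn_star`).

A point of the `k`-stratum, `k < n`, lies in the open star of some `σ` of dimension `n - k`. Scaling
the coefficient of `b σ` to 1 and separating the coefficients above and below `σ` identifies this
star with `ℝ^k × (ℝ^e × [0,∞))`, the half line recording the distance to the sphere
(`openStarHomeomorph`). The half space `ℝ^e × [0,∞)` is the open cone on the closed ball `B^e`
(`openConeBallHomeomorph`), and its subcones match the filtration
(`mem_dualFiltration_iff_mem_subcone`). So the link is `B^e` with the filtration dual to the link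
triangulation, and induction on `n` finishes the proof.

For a fan, chain coordinates arise by subtracting from a point of `σ` the largest possible multiple
of `b σ`; what remains lies in a proper face. -/

theorem exists_norm_le_mul_norm_of_isClosed_cone {K : Set E} (hK : IsClosed K)
    (hsmul : ∀ a ∈ K, ∀ t : ℝ, 0 ≤ t → t • a ∈ K) (f : E →ₗ[ℝ] V)
    (hf : ∀ a ∈ K, f a = 0 → a = 0) : ∃ C : ℝ, 0 < C ∧ ∀ a ∈ K, ‖a‖ ≤ C * ‖f a‖ := by
  have hcont : Continuous f := f.continuous_of_finiteDimensional
  have hcomp : IsCompact (K ∩ Metric.sphere (0 : E) 1) := (isCompact_sphere 0 1).inter_left hK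
  rcases (K ∩ Metric.sphere (0 : E) 1).eq_empty_or_nonempty with hempty | hne
  · refine ⟨1, one_pos, fun a ha => ?_⟩
    by_cases h0 : a = 0
    · simp [h0]
    · exfalso
      have : ‖a‖⁻¹ • a ∈ K ∩ Metric.sphere (0 : E) 1 :=
        ⟨hsmul a ha _ (by positivity), by simp [norm_smul, h0]⟩
      simp [hempty] at this
  · obtain ⟨a₀, ha₀, hmin⟩ := hcomp.exists_isMinOn hne (hcont.norm.continuousOn)
    have hpos : 0 < ‖f a₀‖ := by
      rw [norm_pos_iff]
      intro h
      have h1 := hf a₀ ha₀.1 h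
      have h2 : ‖a₀‖ = 1 := by simpa using ha₀.2
      simp [h1] at h2
    refine ⟨‖f a₀‖⁻¹, by positivity, fun a ha => ?_⟩
    by_cases h0 : a = 0
    · simp [h0]
    · have hmem : ‖a‖⁻¹ • a ∈ K ∩ Metric.sphere (0 : E) 1 :=
        ⟨hsmul a ha _ (by positivity), by simp [norm_smul, h0]⟩
      have h1 : ‖f a₀‖ ≤ ‖f (‖a‖⁻¹ • a)‖ := hmin hmem
      rw [map_smul, norm_smul, norm_inv, norm_norm] at h1
      have hapos : 0 < ‖a‖ := norm_pos_iff.2 h0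
      rw [inv_mul_eq_div, le_div_iff₀ hapos] at h1
      rw [inv_mul_eq_div, le_div_iff₀ hpos]
      linarith

/-- The linear lower bound on `‖f a‖` sends infinity to infinity. This is the source both of the
continuity of `chainCoord` and of the closedness of polyhedral cones. -/
theorem isProperMap_restrict_of_isClosed_cone {K : Set E} (hK : IsClosed K)
    (hsmul : ∀ a ∈ K, ∀ t : ℝ, 0 ≤ t → t • a ∈ K) (f : E →ₗ[ℝ] V) [FiniteDimensional ℝ V]
    (hf : ∀ a ∈ K, f a = 0 → a = 0) : IsProperMap (K.domRestrict f) := by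
  obtain ⟨C, hC, hle⟩ := exists_norm_le_mul_norm_of_isClosed_cone hK hsmul f hf
  have hcont : Continuous f := f.continuous_of_finiteDimensional
  refine isProperMap_iff_tendsto_cocompact.2 ⟨hcont.comp continuous_subtype_val, ?_⟩
  rw [← Metric.cobounded_eq_cocompact (α := V), ← tendsto_norm_atTop_iff_cobounded]
  have : ProperSpace E := FiniteDimensional.proper ℝ E
  have h1 : Filter.Tendsto (fun a : K => C⁻¹ * ‖(a : E)‖) (Filter.cocompact K) Filter.atTop :=
    ((tendsto_norm_cocompact_atTop (E := E)).comp
      hK.isClosedEmbedding_subtypeVal.tendsto_cocompact).const_mul_atTop (by positivity)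
  refine Filter.tendsto_atTop_mono (fun a => ?_) h1
  rw [inv_mul_eq_div, div_le_iff₀ hC]
  simpa [mul_comm] using hle a a.2

end ClosedCone

/-! ### Coordinates with respect to a conical triangulation -/

/-- The cone on the order complex of `P`: nonnegative functions whose support is a chain. -/
def chainCone (P : Type*) [PartialOrder P] : Set (P → ℝ) :=
  {a | (∀ τ, 0 ≤ a τ) ∧ IsChain (· ≤ ·) (Function.support a)}

/-- The linear map `a ↦ ∑ τ, a τ • b τ`. -/
abbrev conicalSum {P V : Type*} [Fintype P] [AddCommGroup V] [Module ℝ V] (b : P → V) :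
    (P → ℝ) →ₗ[ℝ] V :=
  Fintype.linearCombination ℝ b

section ExtendZero

variable {P V : Type*}

/-- The restriction of a function on a set to a function on the whole space, by zero. -/
noncomputable def extendZero {Q : Set P} (c : Q → ℝ) : P → ℝ :=
  open scoped Classical in fun τ => if h : τ ∈ Q then c ⟨τ, h⟩ else 0

theorem extendZero_of_mem {Q : Set P} (c : Q → ℝ) {τ : P} (h : τ ∈ Q) :
    extendZero c τ = c ⟨τ, h⟩ := by simp [extendZero, h]

theorem extendZero_val {Q : Set P} (c : Q → ℝ) (τ : Q) :
    extendZero c τ = c τ := by simp [extendZero]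

theorem extendZero_of_notMem {Q : Set P} (c : Q → ℝ) {τ : P} (h : τ ∉ Q) :
    extendZero c τ = 0 := by simp [extendZero, h]

theorem mem_of_extendZero_ne_zero {Q : Set P} {c : Q → ℝ} {τ : P} (h : extendZero c τ ≠ 0) :
    τ ∈ Q := by
  by_contra h'
  exact h (extendZero_of_notMem c h')

theorem extendZero_comp_val {Q : Set P} {a : P → ℝ} (h : ∀ τ, a τ ≠ 0 → τ ∈ Q) :
    extendZero (fun τ : Q => a τ) = a := by
  ext τ
  by_cases hτ : τ ∈ Q
  · rw [extendZero_of_mem _ hτ]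
  · rw [extendZero_of_notMem _ hτ]
    by_contra h0
    exact hτ (h τ (Ne.symm h0))

theorem continuous_extendZero (Q : Set P) : Continuous (extendZero : (Q → ℝ) → P → ℝ) := by
  refine continuous_pi fun τ => ?_
  by_cases hτ : τ ∈ Q
  · simp only [extendZero_of_mem _ hτ]; fun_prop
  · simp only [extendZero_of_notMem _ hτ]; fun_prop

variable [AddCommGroup V] [Module ℝ V] [Fintype P]

theorem conicalSum_comp_val (Q : Set P) [Fintype Q] (b : P → V) (c : Q → ℝ) :
    conicalSum (fun τ : Q => b τ) c = conicalSum b (extendZero c) := by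
  simp only [Fintype.linearCombination_apply]
  refine Fintype.sum_of_injective _ Subtype.val_injective _ _ (fun τ hτ => ?_) fun τ => ?_
  · rw [extendZero_of_notMem _ (by simpa using hτ), zero_smul]
  · rw [extendZero_val]

theorem conicalSum_single [DecidableEq P] (b : P → V) (σ : P) (t : ℝ) :
    conicalSum b (Pi.single σ t) = t • b σ := by
  simp

theorem conicalSum_mem_span (b : P → V) {a : P → ℝ} {Q : Set P} (h : ∀ τ, a τ ≠ 0 → τ ∈ Q) :
    conicalSum b a ∈ Submodule.span ℝ (b '' Q) := by
  rw [Fintype.linearCombination_apply]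
  refine Submodule.sum_mem _ fun τ _ => ?_
  by_cases h0 : a τ = 0
  · simp [h0]
  · exact Submodule.smul_mem _ _ (Submodule.subset_span ⟨τ, h τ h0, rfl⟩)

theorem map_conicalSum {V' : Type*} [AddCommGroup V'] [Module ℝ V'] (f : V →ₗ[ℝ] V') (b : P → V)
    (a : P → ℝ) : f (conicalSum b a) = conicalSum (fun τ => f (b τ)) a := by
  simp [Fintype.linearCombination_apply]

end ExtendZero

section ChainCone

variable {P V : Type*} [PartialOrder P]

theorem mem_chainCone_iff {a : P → ℝ} :
    a ∈ chainCone P ↔ (∀ τ, 0 ≤ a τ) ∧ ∀ σ τ, a σ ≠ 0 → a τ ≠ 0 → σ ≤ τ ∨ τ ≤ σ := by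
  refine and_congr_right fun _ => ⟨fun h σ τ hσ hτ => h.total hσ hτ, fun h σ hσ τ hτ _ => h σ τ hσ hτ⟩

theorem zero_mem_chainCone : (0 : P → ℝ) ∈ chainCone P := by
  simp [mem_chainCone_iff]

theorem smul_mem_chainCone {a : P → ℝ} (ha : a ∈ chainCone P) {t : ℝ} (ht : 0 ≤ t) :
    t • a ∈ chainCone P := by
  rw [mem_chainCone_iff] at ha ⊢
  refine ⟨fun τ => mul_nonneg ht (ha.1 τ), fun σ τ hσ hτ => ha.2 σ τ ?_ ?_⟩
  · exact right_ne_zero_of_mul hσ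
  · exact right_ne_zero_of_mul hτ

theorem add_mem_chainCone {a c : P → ℝ} (ha : a ∈ chainCone P) (hc : c ∈ chainCone P)
    (h : ∀ σ τ, a σ ≠ 0 → c τ ≠ 0 → σ ≤ τ ∨ τ ≤ σ) : a + c ∈ chainCone P := by
  rw [mem_chainCone_iff] at ha hc ⊢
  have key : ∀ σ, (a + c) σ ≠ 0 → a σ ≠ 0 ∨ c σ ≠ 0 := by
    intro σ hσ
    by_contra! h0
    simp [h0.1, h0.2] at hσ
  refine ⟨fun τ => add_nonneg (ha.1 τ) (hc.1 τ), fun σ τ hσ hτ => ?_⟩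
  rcases key σ hσ with h1 | h1 <;> rcases key τ hτ with h2 | h2
  · exact ha.2 σ τ h1 h2
  · exact h σ τ h1 h2
  · exact (h τ σ h2 h1).symm
  · exact hc.2 σ τ h1 h2

theorem single_mem_chainCone [DecidableEq P] (σ : P) {t : ℝ} (ht : 0 ≤ t) :
    Pi.single σ t ∈ chainCone P := by
  rw [mem_chainCone_iff]
  have key : ∀ τ, (Pi.single σ t : P → ℝ) τ ≠ 0 → τ = σ := by
    intro τ hτ
    by_contra h
    simp [h] at hτ
  refine ⟨fun τ => ?_, fun τ ρ hτ hρ => ?_⟩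
  · by_cases h : τ = σ
    · subst h; simpa
    · simp [h]
  · rw [key τ hτ, key ρ hρ]; exact Or.inl le_rfl

theorem comp_val_mem_chainCone {a : P → ℝ} (ha : a ∈ chainCone P) (Q : Set P) :
    (fun τ : Q => a τ) ∈ chainCone Q := by
  rw [mem_chainCone_iff] at ha ⊢
  exact ⟨fun τ => ha.1 τ, fun σ τ hσ hτ => ha.2 σ τ hσ hτ⟩

theorem isClosed_chainCone : IsClosed (chainCone P) := by
  -- Having chain support is a closed condition: for incomparable `σ`, `τ` the product of the
  -- coefficients vanishes.
  have : chainCone P = (⋂ τ, {a | 0 ≤ a τ}) ∩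
      ⋂ σ, ⋂ τ, ⋂ (_ : ¬ (σ ≤ τ ∨ τ ≤ σ)), {a | a σ * a τ = 0} := by
    ext a
    simp only [mem_chainCone_iff, mem_inter_iff, mem_iInter, mem_ofPred_eq, mul_eq_zero]
    refine and_congr_right fun _ => forall_congr' fun σ => forall_congr' fun τ => ?_
    tauto
  rw [this]
  refine (isClosed_iInter fun τ => isClosed_le continuous_const (continuous_apply τ)).inter
    (isClosed_iInter fun σ => isClosed_iInter fun τ => isClosed_iInter fun _ =>
      isClosed_eq ((continuous_apply σ).mul (continuous_apply τ)) continuous_const)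

theorem extendZero_mem_chainCone {Q : Set P} {c : Q → ℝ} (hc : c ∈ chainCone Q) :
    extendZero c ∈ chainCone P := by
  rw [mem_chainCone_iff] at hc ⊢
  constructor
  · intro τ
    by_cases h : τ ∈ Q
    · rw [extendZero_of_mem c h]; exact hc.1 _
    · rw [extendZero_of_notMem c h]
  · intro σ τ hσ hτ
    have h1 := mem_of_extendZero_ne_zero hσ
    have h2 := mem_of_extendZero_ne_zero hτ
    rw [extendZero_of_mem c h1] at hσ
    rw [extendZero_of_mem c h2] at hτ
    exact hc.2 _ _ hσ hτ

variable [AddCommGroup V] [Module ℝ V] [Fintype P]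

/-- The coefficients of a vector as a conical combination with chain support. -/
noncomputable def chainCoord (b : P → V) : V → P → ℝ :=
  Function.invFunOn (conicalSum b) (chainCone P)

variable {b : P → V} (hb : BijOn (conicalSum b) (chainCone P) univ)
include hb

theorem chainCoord_mem (x : V) : chainCoord b x ∈ chainCone P :=
  Function.invFunOn_mem (hb.surjOn (mem_univ x))

theorem conicalSum_chainCoord (x : V) : conicalSum b (chainCoord b x) = x :=
  Function.invFunOn_eq (hb.surjOn (mem_univ x))

theorem chainCoord_conicalSum {a : P → ℝ} (ha : a ∈ chainCone P) :
    chainCoord b (conicalSum b a) = a :=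
  hb.injOn (chainCoord_mem hb _) ha (conicalSum_chainCoord hb _)

theorem chainCoord_eq {a : P → ℝ} (ha : a ∈ chainCone P) {x : V} (h : conicalSum b a = x) :
    chainCoord b x = a := h ▸ chainCoord_conicalSum hb ha

theorem chainCoord_smul {t : ℝ} (ht : 0 ≤ t) (x : V) :
    chainCoord b (t • x) = t • chainCoord b x :=
  chainCoord_eq hb (smul_mem_chainCone (chainCoord_mem hb x) ht)
    (by rw [map_smul, conicalSum_chainCoord hb])

theorem chainCoord_nonneg (x : V) (τ : P) : 0 ≤ chainCoord b x τ := (chainCoord_mem hb x).1 τ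

theorem chainCoord_zero : chainCoord b 0 = 0 :=
  chainCoord_eq hb zero_mem_chainCone (map_zero _)

theorem chainCoord_total (x : V) {σ τ : P} (hσ : chainCoord b x σ ≠ 0)
    (hτ : chainCoord b x τ ≠ 0) : σ ≤ τ ∨ τ ≤ σ :=
  (mem_chainCone_iff.1 (chainCoord_mem hb x)).2 σ τ hσ hτ

theorem exists_chainCoord_ne_zero {x : V} (hx : x ≠ 0) : ∃ τ, chainCoord b x τ ≠ 0 := by
  by_contra! h
  apply hx
  rw [← conicalSum_chainCoord hb x, show chainCoord b x = 0 from funext h, map_zero]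

end ChainCone

/-- The preimage of a closed set under the coordinates is its image under the summation map, which
is proper on `chainCone P` and hence closed. -/
theorem continuous_chainCoord {P V : Type*} [PartialOrder P] [NormedAddCommGroup V]
    [NormedSpace ℝ V] [FiniteDimensional ℝ V] [Fintype P] {b : P → V}
    (hb : BijOn (conicalSum b) (chainCone P) univ) : Continuous (chainCoord b) := by
  have hproper := isProperMap_restrict_of_isClosed_cone isClosed_chainCone
    (fun a ha t ht => smul_mem_chainCone ha ht) (conicalSum b)
    (fun a ha h => hb.injOn ha zero_mem_chainCone (by simpa using h))
  refine continuous_iff_isClosed.2 fun s hs => ?_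
  have : chainCoord b ⁻¹' s = (chainCone P).domRestrict (conicalSum b) '' (Subtype.val ⁻¹' s) := by
    ext x
    constructor
    · intro hx
      exact ⟨⟨chainCoord b x, chainCoord_mem hb x⟩, hx, conicalSum_chainCoord hb x⟩
    · rintro ⟨a, ha, rfl⟩
      change chainCoord b (conicalSum b a) ∈ s
      rwa [chainCoord_conicalSum hb a.2]
  rw [this]
  exact hproper.isClosedMap _ (hs.preimage continuous_subtype_val)

/-! ### Conical triangulations and their links -/

section ConicalTriangulation

variable {P V : Type*} [PartialOrder P]

/-- The linear span of the vectors `b τ`, `τ ≤ σ`. -/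
def coneSpan [AddCommGroup V] [Module ℝ V] (b : P → V) (σ : P) : Submodule ℝ V :=
  Submodule.span ℝ (b '' Iic σ)

/-- The vectors `b τ` span a triangulation of `V` by simplicial cones, one for each chain of `P`,
such that `b σ` is interior to the union of the cones that belong to chains below `σ`, relative to
the linear span of this union. -/
structure IsConicalTriangulation [Fintype P] [AddCommGroup V] [Module ℝ V] (b : P → V) :
    Prop where
  bijOn : BijOn (conicalSum b) (chainCone P) univ
  absorb : ∀ σ, ∀ w ∈ coneSpan b σ, ∃ T : ℝ, 0 ≤ T ∧ ∃ a ∈ chainCone P,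
    (∀ τ, a τ ≠ 0 → τ ≤ σ) ∧ conicalSum b a = T • b σ + w

section Algebra

variable [AddCommGroup V] [Module ℝ V] {b : P → V}

theorem mem_coneSpan {σ τ : P} (h : τ ≤ σ) : b τ ∈ coneSpan b σ :=
  Submodule.subset_span ⟨τ, h, rfl⟩

theorem coneSpan_mono {σ τ : P} (h : τ ≤ σ) : coneSpan b τ ≤ coneSpan b σ :=
  Submodule.span_mono (image_mono (Iic_subset_Iic.2 h))

theorem coneSpan_Iio {V' : Type*} [AddCommGroup V'] [Module ℝ V'] (f : V →ₗ[ℝ] V') (σ : P)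
    (ρ : Iio σ) :
    coneSpan (fun τ : Iio σ => f (b τ)) ρ = (coneSpan b ρ).map f := by
  rw [coneSpan, coneSpan, Submodule.map_span, image_image]
  congr 1
  ext v
  constructor
  · rintro ⟨τ, hτ, rfl⟩
    exact ⟨τ, hτ, rfl⟩
  · rintro ⟨τ, hτ, rfl⟩
    exact ⟨⟨τ, lt_of_le_of_lt hτ ρ.2⟩, hτ, rfl⟩

variable [Fintype P]

variable (h : IsConicalTriangulation b)
include h

/-- Otherwise `-b σ` is absorbed by a multiple of `b ρ`, which yields two chain representations of
`T • b ρ`. Comparing coefficients at `σ` makes a nonnegative number equal to `-1`. -/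
theorem IsConicalTriangulation.notMem_coneSpan {ρ σ : P} (hρ : ρ < σ) : b σ ∉ coneSpan b ρ := by
  classical
  intro hmem
  obtain ⟨T, hT, a, ha, hsupp, hsum⟩ := h.absorb ρ _ (neg_mem hmem)
  have h1 : conicalSum b (a + Pi.single σ 1) = conicalSum b (Pi.single ρ T) := by
    rw [map_add, hsum, conicalSum_single, conicalSum_single]; module
  have h2 : a + Pi.single σ 1 ∈ chainCone P := by
    refine add_mem_chainCone ha (single_mem_chainCone σ zero_le_one) fun τ τ' hτ hτ' => ?_
    have : τ' = σ := by
      by_contra h0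
      simp [h0] at hτ'
    exact Or.inl (this ▸ (hsupp τ hτ).trans hρ.le)
  have h3 := congr_fun (h.bijOn.injOn h2 (single_mem_chainCone ρ hT) h1) σ
  have h4 := ha.1 σ
  simp [hρ.ne'] at h3
  linarith

theorem IsConicalTriangulation.ne_zero (σ : P) : b σ ≠ 0 := by
  classical
  intro h0
  have h1 := h.bijOn.injOn (single_mem_chainCone σ zero_le_one) zero_mem_chainCone
    (by rw [conicalSum_single, h0, smul_zero, map_zero])
  simpa using congr_fun h1 σ

/-- The hypotheses make `f` identify the span of `σ` modulo the line of `b σ` with `V'`. Two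
combinations with equal image differ by `s • b σ`; moved to the side where its coefficient is
nonnegative, this term extends a chain below `σ` to a chain in `P`. Existence comes from `absorb` at
`σ`, the coefficient at `σ` being lost under `f`. -/
theorem IsConicalTriangulation.link {V' : Type*} [AddCommGroup V'] [Module ℝ V'] (σ : P)
    [Fintype (Iio σ)] (f : V →ₗ[ℝ] V') (hσ : f (b σ) = 0)
    (hker : ∀ v ∈ coneSpan b σ, f v = 0 → ∃ s : ℝ, v = s • b σ)
    (hsurj : ∀ v', ∃ v ∈ coneSpan b σ, f v = v') :
    IsConicalTriangulation (fun τ : Iio σ => f (b τ)) := by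
  classical
  have hsum (c : Iio σ → ℝ) :
      conicalSum (fun τ : Iio σ => f (b τ)) c = f (conicalSum b (extendZero c)) := by
    rw [map_conicalSum, ← conicalSum_comp_val]
  have hspan (c : Iio σ → ℝ) : conicalSum b (extendZero c) ∈ coneSpan b σ :=
    conicalSum_mem_span b fun _ hτ => (mem_of_extendZero_ne_zero hτ : _ ∈ Iio σ).le
  refine ⟨⟨mapsTo_univ _ _, ?_, ?_⟩, ?_⟩
  · have key : ∀ c ∈ chainCone (Iio σ), ∀ c' ∈ chainCone (Iio σ), ∀ s : ℝ, 0 ≤ s →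
        conicalSum b (extendZero c) - conicalSum b (extendZero c') = s • b σ → c = c' := by
      intro c hc c' hc' s hs heq
      have h1 : conicalSum b (extendZero c) = conicalSum b (extendZero c' + Pi.single σ s) := by
        rw [map_add, conicalSum_single, ← heq]; abel
      have h2 : extendZero c' + Pi.single σ s ∈ chainCone P := by
        refine add_mem_chainCone (extendZero_mem_chainCone hc') (single_mem_chainCone σ hs)
          fun τ τ' hτ hτ' => ?_
        have : τ' = σ := by
          by_contra h0
          simp [h0] at hτ'
        exact Or.inl (this ▸ (mem_Iio.1 (mem_of_extendZero_ne_zero hτ)).le)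
      have h3 := h.bijOn.injOn (extendZero_mem_chainCone hc) h2 h1
      ext τ
      have h4 := congr_fun h3 τ
      rwa [Pi.add_apply, extendZero_val, extendZero_val, Pi.single_eq_of_ne (ne_of_lt τ.2),
        add_zero] at h4
    intro c hc c' hc' heq
    simp only [hsum] at heq
    obtain ⟨s, hs⟩ := hker _ (sub_mem (hspan c) (hspan c')) (by rw [map_sub, heq, sub_self])
    rcases le_total 0 s with h0 | h0
    · exact key c hc c' hc' s h0 hs
    · refine (key c' hc' c hc (-s) (by linarith) ?_).symm
      rw [neg_smul, ← hs]; abel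
  · intro v' _
    obtain ⟨v, hv, rfl⟩ := hsurj v'
    obtain ⟨T, hT, a, ha, hsupp, hsa⟩ := h.absorb σ v hv
    refine ⟨fun τ => a τ, comp_val_mem_chainCone ha _, ?_⟩
    have h1 : extendZero (fun τ : Iio σ => a τ) + Pi.single σ (a σ) = a := by
      ext τ
      rcases eq_or_ne τ σ with rfl | hne
      · rw [Pi.add_apply, extendZero_of_notMem _ self_notMem_Iio, Pi.single_eq_same, zero_add]
      · rw [Pi.add_apply, Pi.single_eq_of_ne hne, add_zero]
        by_cases h0 : τ < σ
        · rw [extendZero_of_mem _ (mem_Iio.2 h0)]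
        · rw [extendZero_of_notMem _ (mt mem_Iio.1 h0)]
          by_contra h2
          exact h0 (lt_of_le_of_ne (hsupp τ (Ne.symm h2)) hne)
    have h2 := congr_arg (fun a => f (conicalSum b a)) h1
    simp only [map_add, conicalSum_single, map_smul, hσ, smul_zero, add_zero, hsa, zero_add] at h2
    rw [hsum, h2]
  · intro ρ w hw
    rw [coneSpan_Iio] at hw
    obtain ⟨v, hv, rfl⟩ := hw
    obtain ⟨T, hT, a, ha, hsupp, hsa⟩ := h.absorb ρ v hv
    refine ⟨T, hT, fun τ => a τ, comp_val_mem_chainCone ha _, fun τ hτ => hsupp τ hτ, ?_⟩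
    rw [hsum, extendZero_comp_val fun τ hτ => mem_Iio.2 (lt_of_le_of_lt (hsupp τ hτ) ρ.2), hsa, map_add,
      map_smul]

/-- Since `b σ` is outside the span of `ρ < σ`, the map `f` is injective on that span. Dimensions of
cones are thus preserved while the ambient dimension drops. -/
theorem IsConicalTriangulation.finrank_coneSpan_link {V' : Type*} [AddCommGroup V'] [Module ℝ V']
    {σ : P} (f : V →ₗ[ℝ] V')
    (hker : ∀ v ∈ coneSpan b σ, f v = 0 → ∃ s : ℝ, v = s • b σ) (ρ : Iio σ) :
    Module.finrank ℝ (coneSpan (fun τ : Iio σ => f (b τ)) ρ) =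
      Module.finrank ℝ (coneSpan b (ρ : P)) := by
  rw [coneSpan_Iio, ← LinearMap.range_domRestrict]
  refine LinearMap.finrank_range_of_inj ?_
  rw [injective_iff_map_eq_zero]
  rintro ⟨v, hv⟩ h0
  obtain ⟨s, rfl⟩ := hker v (coneSpan_mono (le_of_lt ρ.2) hv) h0
  by_cases hs : s = 0
  · simp [hs]
  · exact absurd ((Submodule.smul_mem_iff _ hs).1 hv) (h.notMem_coneSpan ρ.2)

/-- A triangulated space of positive dimension is the span of a full-dimensional cone. -/
theorem IsConicalTriangulation.exists_coneSpan_eq_top [Nontrivial V] : ∃ σ, coneSpan b σ = ⊤ := by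
  -- The zero vector has empty support, without a largest element, so `⊥` is added to the cover. A
  -- real vector space is not a finite union of proper subspaces.
  let p : Option P → Submodule ℝ V := fun o => o.elim ⊥ (coneSpan b)
  have hcover : ⋃ i, (p i : Set V) = univ := by
    refine eq_univ_of_forall fun v => ?_
    by_cases h0 : v = 0
    · exact mem_iUnion.2 ⟨none, by simp [h0]⟩
    · have hfin : (Function.support (chainCoord b v)).Finite := toFinite _
      obtain ⟨τ, hτ⟩ := exists_chainCoord_ne_zero h.bijOn h0
      obtain ⟨σ, hσ⟩ := hfin.exists_maximal ⟨τ, hτ⟩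
      refine mem_iUnion.2 ⟨some σ, ?_⟩
      have := conicalSum_mem_span b (a := chainCoord b v) (Q := Iic σ) fun ρ hρ => by
        rcases chainCoord_total h.bijOn v hρ hσ.1 with h1 | h1
        · exact h1
        · exact hσ.2 hρ h1
      rwa [conicalSum_chainCoord h.bijOn] at this
  obtain ⟨i, hi⟩ := Subspace.exists_eq_top_of_iUnion_eq_univ hcover
  cases i with
  | none => exact absurd hi bot_ne_top
  | some σ => exact ⟨σ, hi⟩

variable [FiniteDimensional ℝ V]

theorem IsConicalTriangulation.finrank_coneSpan_lt {ρ σ : P} (hρ : ρ < σ) :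
    Module.finrank ℝ (coneSpan b ρ) < Module.finrank ℝ (coneSpan b σ) :=
  Submodule.finrank_lt_finrank_of_lt (lt_of_le_of_ne (coneSpan_mono hρ.le) fun h0 =>
    h.notMem_coneSpan hρ (h0 ▸ mem_coneSpan le_rfl))

theorem IsConicalTriangulation.finrank_coneSpan_pos (σ : P) :
    0 < Module.finrank ℝ (coneSpan b σ) := by
  have : Nontrivial (coneSpan b σ) :=
    ⟨⟨⟨b σ, mem_coneSpan le_rfl⟩, 0, fun h0 => h.ne_zero σ (congr_arg Subtype.val h0)⟩⟩
  exact Module.finrank_pos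

/-- The span of `σ` modulo the line of `b σ` has dimension `e`; the quotient map is extended to `V`
arbitrarily. -/
theorem IsConicalTriangulation.exists_link_projection {σ : P} {e : ℕ}
    (he : Module.finrank ℝ (coneSpan b σ) = e + 1) :
    ∃ f : V →ₗ[ℝ] EuclideanSpace ℝ (Fin e), f (b σ) = 0 ∧
      (∀ v ∈ coneSpan b σ, f v = 0 → ∃ s : ℝ, v = s • b σ) ∧
      ∀ v', ∃ v ∈ coneSpan b σ, f v = v' := by
  let p : coneSpan b σ := ⟨b σ, mem_coneSpan le_rfl⟩
  have hp : p ≠ 0 := fun h0 => h.ne_zero σ (congr_arg Subtype.val h0)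
  have hfr : Module.finrank ℝ (coneSpan b σ ⧸ Submodule.span ℝ {p}) =
      Module.finrank ℝ (EuclideanSpace ℝ (Fin e)) := by
    have h1 := Submodule.finrank_quotient_add_finrank (Submodule.span ℝ {p})
    rw [finrank_span_singleton hp, he] at h1
    rw [finrank_euclideanSpace_fin]
    omega
  let g := LinearEquiv.ofFinrankEq _ _ hfr
  obtain ⟨f, hf⟩ := LinearMap.exists_extend (g.toLinearMap ∘ₗ (Submodule.span ℝ {p}).mkQ)
  have hf' (v : coneSpan b σ) : f v = g ((Submodule.span ℝ {p}).mkQ v) := LinearMap.congr_fun hf v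
  refine ⟨f, ?_, fun v hv h0 => ?_, fun v' => ?_⟩
  · rw [hf' p, map_eq_zero_iff g g.injective]
    simp
  · rw [hf' ⟨v, hv⟩, map_eq_zero_iff g g.injective] at h0
    rw [Submodule.mkQ_apply, Submodule.Quotient.mk_eq_zero, Submodule.mem_span_singleton] at h0
    obtain ⟨s, hs⟩ := h0
    exact ⟨s, (congr_arg Subtype.val hs).symm⟩
  · obtain ⟨w, hw⟩ := g.surjective v'
    obtain ⟨v, rfl⟩ := Submodule.mkQ_surjective _ w
    exact ⟨v, v.2, by rw [hf', hw]⟩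

/-- The link of `σ` triangulates a space of dimension one less than `σ` and contains a cone spanning
it, so dimensions can be lowered one at a time. This puts points of `Q_i` into duals of cones of
codimension exactly `i`. -/
theorem IsConicalTriangulation.exists_le_finrank_coneSpan_eq (σ : P) {l : ℕ} (hl : 0 < l)
    (hlσ : l ≤ Module.finrank ℝ (coneSpan b σ)) :
    ∃ ρ ≤ σ, Module.finrank ℝ (coneSpan b ρ) = l := by
  classical
  induction hm : Module.finrank ℝ (coneSpan b σ) generalizing σ with
  | zero => omega
  | succ e ih =>
    rcases eq_or_lt_of_le hlσ with heq | hlt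
    · exact ⟨σ, le_rfl, heq.symm⟩
    · obtain ⟨f, hσ, hker, hsurj⟩ := h.exists_link_projection hm
      have hlink := h.link σ f hσ hker hsurj
      have : Nontrivial (EuclideanSpace ℝ (Fin e)) :=
        Module.nontrivial_of_finrank_pos (R := ℝ) (by rw [finrank_euclideanSpace_fin]; omega)
      obtain ⟨ρ, hρ⟩ := hlink.exists_coneSpan_eq_top
      have h1 := h.finrank_coneSpan_link f hker ρ
      rw [hρ, finrank_top, finrank_euclideanSpace_fin] at h1
      obtain ⟨ρ', hle, hfr⟩ := ih ρ (by omega) h1.symm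
      exact ⟨ρ', hle.trans (le_of_lt ρ.2), hfr⟩

end Algebra

/-- If two combinations agree modulo the span of `σ`, `absorb` turns their difference into terms at
or below `σ`, which leave the coefficients above `σ` untouched. For surjectivity, a vector is
represented near `b σ`, where all terms not above `σ` die under `f`. -/
theorem IsConicalTriangulation.bijOn_star [Fintype P] [NormedAddCommGroup V] [NormedSpace ℝ V]
    [FiniteDimensional ℝ V] {b : P → V} (h : IsConicalTriangulation b)
    {V' : Type*} [AddCommGroup V'] [Module ℝ V'] (σ : P)
    [Fintype (Ioi σ)] (f : V →ₗ[ℝ] V') (hker : LinearMap.ker f = coneSpan b σ)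
    (hsurj : Function.Surjective f) :
    BijOn (conicalSum fun τ : Ioi σ => f (b τ)) (chainCone (Ioi σ)) univ := by
  classical
  have hsum (c : Ioi σ → ℝ) :
      conicalSum (fun τ : Ioi σ => f (b τ)) c = f (conicalSum b (extendZero c)) := by
    rw [map_conicalSum, ← conicalSum_comp_val]
  have hsingle : ∀ {τ : P} {t : ℝ}, (Pi.single σ t : P → ℝ) τ ≠ 0 → τ = σ := by
    intro τ t hτ
    by_contra h0
    simp [h0] at hτ
  refine ⟨mapsTo_univ _ _, ?_, ?_⟩
  · intro c hc c' hc' heq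
    simp only [hsum] at heq
    have h0 : conicalSum b (extendZero c) - conicalSum b (extendZero c') ∈ coneSpan b σ := by
      rw [← hker, LinearMap.mem_ker, map_sub, heq, sub_self]
    obtain ⟨T, hT, a, ha, hsupp, hsa⟩ := h.absorb σ _ h0
    have h1 : conicalSum b (a + extendZero c') =
        conicalSum b (Pi.single σ T + extendZero c) := by
      rw [map_add, map_add, hsa, conicalSum_single]; abel
    have h2 := h.bijOn.injOn
      (add_mem_chainCone ha (extendZero_mem_chainCone hc') fun τ τ' hτ hτ' =>
        Or.inl ((hsupp τ hτ).trans (le_of_lt (mem_of_extendZero_ne_zero hτ'))))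
      (add_mem_chainCone (single_mem_chainCone σ hT) (extendZero_mem_chainCone hc)
        fun τ τ' hτ hτ' => Or.inl (hsingle hτ ▸ le_of_lt (mem_of_extendZero_ne_zero hτ'))) h1
    ext τ
    have h3 := congr_fun h2 τ
    have h4 : a τ = 0 := by
      by_contra h5
      exact not_lt_of_ge (hsupp τ h5) τ.2
    rw [Pi.add_apply, Pi.add_apply, extendZero_val, extendZero_val, h4,
      Pi.single_eq_of_ne (ne_of_gt τ.2), zero_add, zero_add] at h3
    exact h3.symm
  · intro v' _
    obtain ⟨w, rfl⟩ := hsurj v'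
    -- By continuity the coefficient at `σ` stays positive near `b σ`, which forces the whole
    -- support to be comparable with `σ`.
    have hev : ∀ᶠ t : ℝ in nhdsWithin 0 (Ioi 0), 0 < chainCoord b (b σ + t • w) σ := by
      have hc : Continuous fun t : ℝ => chainCoord b (b σ + t • w) σ :=
        (continuous_apply σ).comp ((continuous_chainCoord h.bijOn).comp (by fun_prop))
      have h0 : 0 < chainCoord b (b σ + (0 : ℝ) • w) σ := by
        rw [chainCoord_eq h.bijOn (single_mem_chainCone σ zero_le_one)
          (x := b σ + (0 : ℝ) • w) (by simp)]
        simp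
      exact nhdsWithin_le_nhds (hc.continuousAt.eventually (lt_mem_nhds h0))
    obtain ⟨t, ht, ht0⟩ := (hev.and self_mem_nhdsWithin).exists
    have ht0 : 0 < t := ht0
    set a := chainCoord b (b σ + t • w) with ha
    have hac := chainCoord_mem h.bijOn (b σ + t • w)
    refine ⟨t⁻¹ • fun τ : Ioi σ => a τ,
      smul_mem_chainCone (comp_val_mem_chainCone hac _) (by positivity), ?_⟩
    have h1 : f (conicalSum b (extendZero fun τ : Ioi σ => a τ)) = f (conicalSum b a) := by
      rw [map_conicalSum, map_conicalSum, Fintype.linearCombination_apply,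
        Fintype.linearCombination_apply]
      refine Finset.sum_congr rfl fun τ _ => ?_
      by_cases hτ : σ < τ
      · rw [extendZero_of_mem _ (mem_Ioi.2 hτ)]
      · rw [extendZero_of_notMem _ (mt mem_Ioi.1 hτ), zero_smul]
        by_cases h0 : a τ = 0
        · rw [h0, zero_smul]
        · have h2 : τ ≤ σ := by
            rcases chainCoord_total h.bijOn _ h0 ht.ne' with h3 | h3
            · exact h3
            · rcases eq_or_lt_of_le h3 with rfl | h4
              · exact le_rfl
              · exact absurd h4 hτ
          have h3 : f (b τ) = 0 := by
            rw [← LinearMap.mem_ker, hker]; exact mem_coneSpan h2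
          rw [h3, smul_zero]
    have h2 : f (b σ) = 0 := by
      rw [← LinearMap.mem_ker, hker]; exact mem_coneSpan le_rfl
    rw [map_smul, hsum, h1, conicalSum_chainCoord h.bijOn, map_add, map_smul, h2, zero_add,
      smul_smul, inv_mul_cancel₀ ht0.ne', one_smul]

theorem exists_star_projection [AddCommGroup V] [Module ℝ V] [FiniteDimensional ℝ V]
    (W : Submodule ℝ V) {k : ℕ} (hk : k + Module.finrank ℝ W = Module.finrank ℝ V) :
    ∃ f : V →ₗ[ℝ] EuclideanSpace ℝ (Fin k), LinearMap.ker f = W ∧ Function.Surjective f := by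
  have hfr : Module.finrank ℝ (V ⧸ W) = Module.finrank ℝ (EuclideanSpace ℝ (Fin k)) := by
    have h1 := W.finrank_quotient_add_finrank
    rw [finrank_euclideanSpace_fin]
    omega
  let g := LinearEquiv.ofFinrankEq _ _ hfr
  refine ⟨g.toLinearMap ∘ₗ W.mkQ, ?_, g.surjective.comp W.mkQ_surjective⟩
  rw [LinearEquiv.ker_comp, Submodule.ker_mkQ]

end ConicalTriangulation

/-! ### The open cone on a ball -/

section OpenCone

universe w

theorem OpenCone.mk_eq_vertex {L : Type w} (x : L) {t : Ico (0 : ℝ) 1} (ht : (t : ℝ) = 0) :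
    OpenCone.mk x t = OpenCone.vertex L :=
  Quot.sound (ConeRel.collapse x t ht)

theorem OpenCone.mk_mem_subcone {L : Type w} {A : Set L} {x : L} {t : Ico (0 : ℝ) 1} :
    OpenCone.mk x t ∈ OpenCone.subcone A ↔ (t : ℝ) = 0 ∨ x ∈ A := by
  constructor
  · intro h
    -- The membership criterion is lifted to the quotient, so that equalities of cone points need
    -- not be analysed.
    let p : OpenCone L → Prop := Quot.lift
      (Sum.elim (fun y => (y.2 : ℝ) = 0 ∨ y.1 ∈ A) fun _ => True) <| by
        rintro _ _ ⟨x, t, ht⟩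
        exact eq_true (Or.inl ht)
    suffices ∀ z ∈ OpenCone.subcone A, p z from this _ h
    rintro z (rfl | ⟨y, hy, s, rfl⟩)
    · exact trivial
    · exact Or.inr hy
  · rintro (h | h)
    · exact Or.inl (OpenCone.mk_eq_vertex x h)
    · exact Or.inr ⟨x, h, t, rfl⟩

theorem OpenCone.continuous_mk {L : Type w} [TopologicalSpace L] :
    Continuous fun p : L × Ico (0 : ℝ) 1 => OpenCone.mk p.1 p.2 :=
  continuous_quot_mk.comp continuous_inl

/-- Neighborhoods of the vertex of the open cone on a compact space are uniform. -/
theorem OpenCone.exists_mk_mem_of_isOpen {L : Type w} [TopologicalSpace L] [CompactSpace L]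
    {W : Set (OpenCone L)} (hW : IsOpen W) (h : OpenCone.vertex L ∈ W) :
    ∃ ε : ℝ, 0 < ε ∧ ∀ (x : L) (t : Ico (0 : ℝ) 1), (t : ℝ) < ε → OpenCone.mk x t ∈ W := by
  let o : Ico (0 : ℝ) 1 := ⟨0, by simp⟩
  obtain ⟨u, v, -, hv, hu, hov, huv⟩ := generalized_tube_lemma (isCompact_univ (X := L))
    (isCompact_singleton (x := o)) (hW.preimage OpenCone.continuous_mk) (by
      rintro ⟨x, t⟩ ⟨-, ht⟩
      have ht : t = o := ht
      rw [mem_preimage, ht, OpenCone.mk_eq_vertex x rfl]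
      exact h)
  obtain ⟨ε, hε, hball⟩ := Metric.isOpen_iff.1 hv o (hov rfl)
  refine ⟨ε, hε, fun x t ht => huv (⟨hu (mem_univ x), hball ?_⟩ : (x, t) ∈ u ×ˢ v)⟩
  rw [Metric.mem_ball, Subtype.dist_eq, Real.dist_eq, sub_zero, abs_of_nonneg t.2.1]
  exact ht

variable {E : Type w} [NormedAddCommGroup E] [NormedSpace ℝ E]

/-- The map from the open cone on the unit ball to the half space, taking the boundary of the ball
to the boundary of the half space. -/
noncomputable def openConeBallToHalfSpace :
    OpenCone (Metric.closedBall (0 : E) 1) → E × Ici (0 : ℝ) :=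
  Quot.lift (Sum.elim
    -- With `r = t / (1 - t)` the point `[x, t]` goes to `(r x, r (1 - ‖x‖))`. The norm of the first
    -- entry plus the second equals `r`, which gives the inverse.
    (fun p => (((p.2 : ℝ) / (1 - p.2)) • (p.1 : E), ⟨(p.2 : ℝ) / (1 - p.2) * (1 - ‖(p.1 : E)‖),
      mul_nonneg (div_nonneg p.2.2.1 (sub_nonneg.2 p.2.2.2.le))
        (sub_nonneg.2 (mem_closedBall_zero_iff.1 p.1.2))⟩))
    fun _ => (0, ⟨0, self_mem_Ici⟩)) <| by
      rintro _ _ ⟨x, t, ht⟩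
      simp [ht]

theorem continuous_openConeBallToHalfSpace :
    Continuous (openConeBallToHalfSpace : OpenCone (Metric.closedBall (0 : E) 1) → _) := by
  refine continuous_quot_lift _ (continuous_sum_dom.2 ⟨?_, continuous_of_discreteTopology⟩)
  have h1 : Continuous fun p : Metric.closedBall (0 : E) 1 × Ico (0 : ℝ) 1 =>
      (p.2 : ℝ) / (1 - p.2) :=
    Continuous.div (by fun_prop) (by fun_prop) fun p => (sub_pos.2 p.2.2.2).ne'
  exact (h1.smul (by fun_prop)).prodMk ((h1.mul (by fun_prop)).subtype_mk _)

/-- The map from the half space to the open cone on the unit ball. -/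
noncomputable def halfSpaceToOpenConeBall (p : E × Ici (0 : ℝ)) :
    OpenCone (Metric.closedBall (0 : E) 1) :=
  have hs : (0 : ℝ) ≤ p.2 := p.2.2
  have hN : 0 ≤ ‖p.1‖ + (p.2 : ℝ) := by positivity
  OpenCone.mk
    ⟨(‖p.1‖ + (p.2 : ℝ))⁻¹ • p.1, by
      rw [mem_closedBall_zero_iff, norm_smul, norm_inv, Real.norm_of_nonneg hN]
      exact inv_mul_le_one_of_le₀ (by linarith) hN⟩
    ⟨(‖p.1‖ + (p.2 : ℝ)) / (1 + (‖p.1‖ + (p.2 : ℝ))), by positivity, by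
      rw [div_lt_one (by positivity)]; linarith⟩

/-- At the origin the direction in the ball need not converge; compactness of the ball makes
smallness of the cone parameter alone sufficient there. -/
theorem continuous_halfSpaceToOpenConeBall [FiniteDimensional ℝ E] :
    Continuous (halfSpaceToOpenConeBall : E × Ici (0 : ℝ) → _) := by
  have : ProperSpace E := FiniteDimensional.proper ℝ E
  have hN : Continuous fun p : E × Ici (0 : ℝ) => ‖p.1‖ + (p.2 : ℝ) := by fun_prop
  have hpos (p : E × Ici (0 : ℝ)) : 0 ≤ ‖p.1‖ + (p.2 : ℝ) := add_nonneg (norm_nonneg _) p.2.2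
  have hT : Continuous fun p : E × Ici (0 : ℝ) =>
      (‖p.1‖ + (p.2 : ℝ)) / (1 + (‖p.1‖ + (p.2 : ℝ))) :=
    hN.div (by fun_prop) fun p => (by linarith [hpos p] : 0 < 1 + (‖p.1‖ + (p.2 : ℝ))).ne'
  refine continuous_iff_continuousAt.2 fun p => ?_
  by_cases h0 : ‖p.1‖ + (p.2 : ℝ) = 0
  · have hv : halfSpaceToOpenConeBall p = OpenCone.vertex _ :=
      OpenCone.mk_eq_vertex _ (by simp [h0])
    rw [ContinuousAt, hv, tendsto_nhds]
    intro W hW hvW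
    obtain ⟨ε, hε, hmem⟩ := OpenCone.exists_mk_mem_of_isOpen hW hvW
    have h1 := (hT.continuousAt (x := p)).eventually (eventually_lt_nhds
      (b := ε) (by simpa [h0] using hε))
    filter_upwards [h1] with q hq
    exact hmem _ _ hq
  · refine OpenCone.continuous_mk.continuousAt.comp (x := p) (f := fun p : E × Ici (0 : ℝ) =>
      ((⟨(‖p.1‖ + (p.2 : ℝ))⁻¹ • p.1, _⟩ : Metric.closedBall (0 : E) 1),
        (⟨(‖p.1‖ + (p.2 : ℝ)) / (1 + (‖p.1‖ + (p.2 : ℝ))), _⟩ : Ico (0 : ℝ) 1))) ?_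
    refine ContinuousAt.prodMk ?_ ?_
    · exact ((hN.continuousAt.inv₀ h0).smul continuous_fst.continuousAt).codRestrict _
    · exact hT.continuousAt.codRestrict _

/-- The open cone on the unit ball of a finite-dimensional space is a half space. -/
noncomputable def openConeBallHomeomorph [FiniteDimensional ℝ E] :
    OpenCone (Metric.closedBall (0 : E) 1) ≃ₜ E × Ici (0 : ℝ) where
  toFun := openConeBallToHalfSpace
  invFun := halfSpaceToOpenConeBall
  left_inv := by
    rintro ⟨⟨⟨x, hx⟩, ⟨t, ht0, ht1⟩⟩ | ⟨⟩⟩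
    · have hx : ‖x‖ ≤ 1 := mem_closedBall_zero_iff.1 hx
      have h1 : 0 < 1 - t := sub_pos.2 ht1
      have hr : 0 ≤ t / (1 - t) := div_nonneg ht0 h1.le
      have hN : ‖(t / (1 - t)) • x‖ + t / (1 - t) * (1 - ‖x‖) = t / (1 - t) := by
        rw [norm_smul, Real.norm_of_nonneg hr]; ring
      change halfSpaceToOpenConeBall ((t / (1 - t)) • x, ⟨t / (1 - t) * (1 - ‖x‖), _⟩) =
        OpenCone.mk ⟨x, _⟩ ⟨t, _⟩
      rcases eq_or_lt_of_le ht0 with h0 | h0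
      · rw [OpenCone.mk_eq_vertex _ h0.symm]
        refine OpenCone.mk_eq_vertex _ ?_
        simp [← h0]
      · have hr' : t / (1 - t) ≠ 0 := (div_pos h0 h1).ne'
        refine congr_arg₂ OpenCone.mk (Subtype.ext ?_) (Subtype.ext ?_)
        · change (‖(t / (1 - t)) • x‖ + t / (1 - t) * (1 - ‖x‖))⁻¹ • (t / (1 - t)) • x = x
          rw [hN, inv_smul_smul₀ hr']
        · change (‖(t / (1 - t)) • x‖ + t / (1 - t) * (1 - ‖x‖)) /
            (1 + (‖(t / (1 - t)) • x‖ + t / (1 - t) * (1 - ‖x‖))) = t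
          rw [hN]
          field_simp
          ring
    · refine OpenCone.mk_eq_vertex _ ?_
      change (‖(0 : E)‖ + 0) / (1 + (‖(0 : E)‖ + 0)) = 0
      simp
  right_inv := by
    rintro ⟨y, ⟨s, hs⟩⟩
    have hs : 0 ≤ s := hs
    have hpos : 0 ≤ ‖y‖ + s := by positivity
    change ((((‖y‖ + s) / (1 + (‖y‖ + s))) / (1 - (‖y‖ + s) / (1 + (‖y‖ + s)))) •
      (‖y‖ + s)⁻¹ • y, (⟨(((‖y‖ + s) / (1 + (‖y‖ + s))) / (1 - (‖y‖ + s) / (1 + (‖y‖ + s)))) *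
        (1 - ‖(‖y‖ + s)⁻¹ • y‖), _⟩ : Ici (0 : ℝ))) = (y, ⟨s, _⟩)
    have h1 : ((‖y‖ + s) / (1 + (‖y‖ + s))) / (1 - (‖y‖ + s) / (1 + (‖y‖ + s))) = ‖y‖ + s := by
      have : 1 + (‖y‖ + s) ≠ 0 := by positivity
      field_simp
      ring
    refine Prod.ext ?_ (Subtype.ext ?_)
    · dsimp only
      rw [h1]
      by_cases h0 : ‖y‖ + s = 0
      · have : ‖y‖ = 0 := by linarith [norm_nonneg y]
        simp [norm_eq_zero.1 this]
      · rw [smul_inv_smul₀ h0]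
    · dsimp only
      rw [h1, norm_smul, norm_inv, Real.norm_of_nonneg hpos]
      by_cases h0 : ‖y‖ + s = 0
      · rw [h0]; linarith [norm_nonneg y]
      · field_simp
        ring
  continuous_toFun := continuous_openConeBallToHalfSpace
  continuous_invFun := continuous_halfSpaceToOpenConeBall

theorem openConeBallHomeomorph_symm_mem_subcone [FiniteDimensional ℝ E]
    {A : Set (Metric.closedBall (0 : E) 1)} {y : E} {s : Ici (0 : ℝ)} :
    openConeBallHomeomorph.symm (y, s) ∈ OpenCone.subcone A ↔
      ‖y‖ + (s : ℝ) = 0 ∨ ∃ x ∈ A, (x : E) = (‖y‖ + (s : ℝ))⁻¹ • y := by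
  have hpos : 0 ≤ ‖y‖ + (s : ℝ) := add_nonneg (norm_nonneg _) s.2
  refine OpenCone.mk_mem_subcone.trans (or_congr ?_ ?_)
  · have h1 : 1 + (‖y‖ + (s : ℝ)) ≠ 0 := by positivity
    exact (div_eq_zero_iff.trans (or_iff_left h1))
  · exact ⟨fun h => ⟨_, h, rfl⟩, fun ⟨x, hx, h⟩ => by rwa [← show x = ⟨_, _⟩ from Subtype.ext h]⟩

end OpenCone

/-! ### Charts around open stars -/

section StarChart

variable {P V : Type*} [PartialOrder P]

/-- The coefficient function with prescribed values below and above `σ` and the value `1` at `σ`. -/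
noncomputable def joinAt (σ : P) (c : Iio σ → ℝ) (d : Ioi σ → ℝ) : P → ℝ :=
  open scoped Classical in extendZero c + Pi.single σ 1 + extendZero d

section

variable {σ : P} {c : Iio σ → ℝ} {d : Ioi σ → ℝ}

theorem joinAt_self : joinAt σ c d σ = 1 := by
  simp [joinAt, extendZero_of_notMem]

theorem joinAt_Iio (τ : Iio σ) : joinAt σ c d τ = c τ := by
  have h : (τ : P) ∉ Ioi σ := fun h => lt_asymm h τ.2
  simp [joinAt, extendZero_val, extendZero_of_notMem _ h, ne_of_lt (mem_Iio.1 τ.2)]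

theorem joinAt_Ioi (τ : Ioi σ) : joinAt σ c d τ = d τ := by
  have h : (τ : P) ∉ Iio σ := fun h => lt_asymm h τ.2
  simp [joinAt, extendZero_val, extendZero_of_notMem _ h, ne_of_gt (mem_Ioi.1 τ.2)]

theorem joinAt_mem_chainCone (hc : c ∈ chainCone (Iio σ)) (hd : d ∈ chainCone (Ioi σ)) :
    joinAt σ c d ∈ chainCone P := by
  classical
  have hsingle : ∀ τ, (Pi.single σ 1 : P → ℝ) τ ≠ 0 → τ = σ := by
    intro τ hτ
    by_contra h0
    simp [h0] at hτ
  have h1 : extendZero c + Pi.single σ 1 ∈ chainCone P :=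
    add_mem_chainCone (extendZero_mem_chainCone hc) (single_mem_chainCone σ zero_le_one)
      fun τ τ' hτ hτ' => Or.inl (hsingle τ' hτ' ▸ (mem_Iio.1 (mem_of_extendZero_ne_zero hτ)).le)
  unfold joinAt
  refine add_mem_chainCone (by convert h1) (extendZero_mem_chainCone hd) fun τ τ' hτ hτ' => Or.inl ?_
  refine le_trans ?_ (mem_Ioi.1 (mem_of_extendZero_ne_zero hτ')).le
  by_contra h0
  have h2 : τ ∉ Iio σ := fun h2 => h0 (le_of_lt h2)
  have h3 : τ ≠ σ := fun h3 => h0 h3.le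
  simp [extendZero_of_notMem _ h2, h3] at hτ

/-- Every element of the support is comparable with `σ`, so no coefficient is lost by restricting to
the elements above and below it. -/
theorem joinAt_restrict {a : P → ℝ} (ha : a ∈ chainCone P) (hσ : a σ ≠ 0) :
    joinAt σ (fun τ => (a σ)⁻¹ * a τ) (fun τ => (a σ)⁻¹ * a τ) = (a σ)⁻¹ • a := by
  ext τ
  by_cases h1 : τ < σ
  · exact joinAt_Iio ⟨τ, h1⟩
  by_cases h2 : σ < τ
  · exact joinAt_Ioi ⟨τ, h2⟩
  by_cases h3 : τ = σ
  · subst h3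
    rw [joinAt_self, Pi.smul_apply, smul_eq_mul, inv_mul_cancel₀ hσ]
  · have h0 : a τ = 0 := by
      by_contra h0
      rcases (mem_chainCone_iff.1 ha).2 τ σ h0 hσ with h | h
      · exact h1 (lt_of_le_of_ne h h3)
      · exact h2 (lt_of_le_of_ne h (Ne.symm h3))
    simp [joinAt, extendZero_of_notMem _ (mt mem_Iio.1 h1), extendZero_of_notMem _ (mt mem_Ioi.1 h2),
      h3, h0]

end

variable [Fintype P] [NormedAddCommGroup V] [NormedSpace ℝ V]
  {V₁ V₂ : Type*} [NormedAddCommGroup V₁] [NormedSpace ℝ V₁] [FiniteDimensional ℝ V₁]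
  [NormedAddCommGroup V₂] [NormedSpace ℝ V₂] [FiniteDimensional ℝ V₂]

/-- The open star of `σ` in the unit ball. -/
def openStar (b : P → V) (σ : P) : Set (Metric.closedBall (0 : V) 1) :=
  {x | 0 < chainCoord b x σ}

theorem ne_zero_of_mem_openStar {b : P → V} (hb : BijOn (conicalSum b) (chainCone P) univ) {σ : P}
    {x : Metric.closedBall (0 : V) 1} (hx : x ∈ openStar b σ) : (x : V) ≠ 0 := by
  intro h0
  have : 0 < chainCoord b x σ := hx
  rw [h0, chainCoord_zero hb] at this
  exact lt_irrefl _ this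

variable [FiniteDimensional ℝ V]

theorem isOpen_openStar {b : P → V} (hb : BijOn (conicalSum b) (chainCone P) univ) (σ : P) :
    IsOpen (openStar b σ) :=
  isOpen_lt continuous_const
    ((continuous_apply σ).comp ((continuous_chainCoord hb).comp continuous_subtype_val))

/-- The open star of `σ` in the unit ball is a product of the spaces triangulated by the elements
above and below `σ`, and of a half line for the radial direction. -/
noncomputable def openStarHomeomorph {b : P → V} (hb : BijOn (conicalSum b) (chainCone P) univ)
    (σ : P) [Fintype (Iio σ)] [Fintype (Ioi σ)] {c : Iio σ → V₁} {d : Ioi σ → V₂}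
    (hc : BijOn (conicalSum c) (chainCone (Iio σ)) univ)
    (hd : BijOn (conicalSum d) (chainCone (Ioi σ)) univ) :
    openStar b σ ≃ₜ V₂ × (V₁ × Ici (0 : ℝ)) :=
  have hmem (p : V₂ × (V₁ × Ici (0 : ℝ))) :
      joinAt σ (chainCoord c p.2.1) (chainCoord d p.1) ∈ chainCone P :=
    joinAt_mem_chainCone (chainCoord_mem hc _) (chainCoord_mem hd _)
  have hcoord (p : V₂ × (V₁ × Ici (0 : ℝ))) :
      chainCoord b (conicalSum b (joinAt σ (chainCoord c p.2.1) (chainCoord d p.1))) =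
        joinAt σ (chainCoord c p.2.1) (chainCoord d p.1) := chainCoord_conicalSum hb (hmem p)
  have hne (p : V₂ × (V₁ × Ici (0 : ℝ))) :
      0 < ‖conicalSum b (joinAt σ (chainCoord c p.2.1) (chainCoord d p.1))‖ := by
    rw [norm_pos_iff]
    intro h0
    have := hcoord p
    rw [h0, chainCoord_zero hb] at this
    simpa [joinAt_self] using congr_fun this σ
  have hs (p : V₂ × (V₁ × Ici (0 : ℝ))) : 0 < 1 + (p.2.2 : ℝ) := by
    have : (0 : ℝ) ≤ p.2.2 := p.2.2.2
    positivity
  have hnorm (p : V₂ × (V₁ × Ici (0 : ℝ))) :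
      ‖(‖conicalSum b (joinAt σ (chainCoord c p.2.1) (chainCoord d p.1))‖ * (1 + p.2.2))⁻¹ •
        conicalSum b (joinAt σ (chainCoord c p.2.1) (chainCoord d p.1))‖ = (1 + p.2.2 : ℝ)⁻¹ := by
    have h1 := hne p
    have h2 := hs p
    rw [norm_smul, norm_inv, Real.norm_of_nonneg (by positivity), mul_inv_rev, mul_assoc,
      inv_mul_cancel₀ h1.ne', mul_one]
  -- Dividing by the coefficient at `σ` makes the first two components invariant under scaling;
  -- `‖x‖⁻¹ - 1` restores the scale and vanishes exactly on the sphere.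
  { toFun := fun x =>
      (conicalSum d (fun τ => (chainCoord b x σ)⁻¹ * chainCoord b x τ),
        (conicalSum c (fun τ => (chainCoord b x σ)⁻¹ * chainCoord b x τ),
          ⟨‖(x : V)‖⁻¹ - 1, sub_nonneg.2 ((one_le_inv₀ (norm_pos_iff.2
            (ne_zero_of_mem_openStar hb x.2))).2 (mem_closedBall_zero_iff.1 x.1.2))⟩))
    invFun := fun p =>
      ⟨⟨(‖conicalSum b (joinAt σ (chainCoord c p.2.1) (chainCoord d p.1))‖ * (1 + p.2.2))⁻¹ •
        conicalSum b (joinAt σ (chainCoord c p.2.1) (chainCoord d p.1)), by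
          rw [mem_closedBall_zero_iff, hnorm p]
          have : (0 : ℝ) ≤ p.2.2 := p.2.2.2
          exact inv_le_one_of_one_le₀ (by linarith)⟩, by
        have h1 := hne p
        have h2 := hs p
        change 0 < chainCoord b (_ • _) σ
        rw [chainCoord_smul hb (by positivity), hcoord, Pi.smul_apply, joinAt_self, smul_eq_mul]
        positivity⟩
    left_inv := by
      rintro ⟨⟨x, hx1⟩, hx⟩
      have hσ : 0 < chainCoord b x σ := hx
      have hx0 : x ≠ 0 := ne_zero_of_mem_openStar hb hx
      have hxn : 0 < ‖x‖ := norm_pos_iff.2 hx0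
      have hac := chainCoord_mem hb x
      refine Subtype.ext (Subtype.ext ?_)
      dsimp only
      rw [chainCoord_conicalSum hc, chainCoord_conicalSum hd, joinAt_restrict hac hσ.ne', map_smul,
        conicalSum_chainCoord hb, norm_smul, norm_inv, Real.norm_of_nonneg hσ.le, smul_smul]
      · convert one_smul ℝ x using 2
        field_simp
        ring
      · exact smul_mem_chainCone (comp_val_mem_chainCone hac _) (by positivity)
      · exact smul_mem_chainCone (comp_val_mem_chainCone hac _) (by positivity)
    right_inv := by
      intro p
      have h1 := hne p
      have h2 := hs p
      have hr : 0 < (‖conicalSum b (joinAt σ (chainCoord c p.2.1) (chainCoord d p.1))‖ *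
        (1 + p.2.2))⁻¹ := by positivity
      have key (τ : P) : (chainCoord b ((‖conicalSum b (joinAt σ (chainCoord c p.2.1)
          (chainCoord d p.1))‖ * (1 + p.2.2))⁻¹ • conicalSum b (joinAt σ (chainCoord c p.2.1)
          (chainCoord d p.1))) σ)⁻¹ * chainCoord b ((‖conicalSum b (joinAt σ (chainCoord c p.2.1)
          (chainCoord d p.1))‖ * (1 + p.2.2))⁻¹ • conicalSum b (joinAt σ (chainCoord c p.2.1)
          (chainCoord d p.1))) τ = joinAt σ (chainCoord c p.2.1) (chainCoord d p.1) τ := by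
        rw [chainCoord_smul hb hr.le, hcoord, Pi.smul_apply, Pi.smul_apply, joinAt_self,
          smul_eq_mul, smul_eq_mul, mul_one, inv_mul_cancel_left₀ hr.ne']
      dsimp only
      refine Prod.ext ?_ (Prod.ext ?_ (Subtype.ext ?_))
      · simp only [key, joinAt_Ioi]
        exact conicalSum_chainCoord hd _
      · simp only [key, joinAt_Iio]
        exact conicalSum_chainCoord hc _
      · dsimp only
        rw [hnorm p, inv_inv, add_sub_cancel_left]
    continuous_toFun := by
      have hcont : Continuous fun x : openStar b σ => chainCoord b x :=
        (continuous_chainCoord hb).comp (continuous_subtype_val.comp continuous_subtype_val)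
      have hcont' (τ : P) : Continuous fun x : openStar b σ =>
          (chainCoord b x σ)⁻¹ * chainCoord b x τ :=
        (((continuous_apply σ).comp hcont).inv₀ fun x => (show 0 < chainCoord b x σ from x.2).ne').mul
          ((continuous_apply τ).comp hcont)
      refine Continuous.prodMk ?_ (Continuous.prodMk ?_ (Continuous.subtype_mk ?_ _))
      · exact (LinearMap.continuous_of_finiteDimensional _).comp
          (continuous_pi fun τ => hcont' τ)
      · exact (LinearMap.continuous_of_finiteDimensional _).comp
          (continuous_pi fun τ => hcont' τ)
      · exact (Continuous.inv₀ (by fun_prop) fun x =>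
          (norm_pos_iff.2 (ne_zero_of_mem_openStar hb x.2)).ne').sub continuous_const
    continuous_invFun := by
      have hz : Continuous fun p : V₂ × (V₁ × Ici (0 : ℝ)) =>
          conicalSum b (joinAt σ (chainCoord c p.2.1) (chainCoord d p.1)) := by
        refine (LinearMap.continuous_of_finiteDimensional _).comp ?_
        refine Continuous.add (Continuous.add ?_ continuous_const) ?_
        · exact (continuous_extendZero _).comp ((continuous_chainCoord hc).comp (by fun_prop))
        · exact (continuous_extendZero _).comp ((continuous_chainCoord hd).comp (by fun_prop))
      refine Continuous.subtype_mk (Continuous.subtype_mk (Continuous.smul ?_ hz) _) _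
      exact (hz.norm.mul (by fun_prop)).inv₀ fun p => (mul_pos (hne p) (hs p)).ne' }

end StarChart

/-! ### The stratified ball of a conical triangulation -/

/-- The sets `A` and `B` separate `F`, so the component of `x` stays in `A`. As a continuous image
of a connected space, the range of `f` fills that component. -/
theorem isTopologicalManifold_connectedComponentIn {X : Type*} [TopologicalSpace X] [T2Space X]
    [SecondCountableTopology X] {k : ℕ} {f : EuclideanSpace ℝ (Fin k) → X}
    (hf : Topology.IsEmbedding f) {F A B : Set X} (hA : IsOpen A) (hB : IsOpen B)
    (hAB : F ⊆ A ∪ B) (hdisj : ∀ y ∈ F, y ∈ A → y ∉ B) (hrange : range f = F ∩ A) {x : X}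
    (hxF : x ∈ F) (hxA : x ∈ A) : IsTopologicalManifold k (connectedComponentIn F x) := by
  have heq : connectedComponentIn F x = range f := by
    apply Subset.antisymm
    · rw [hrange]
      refine subset_inter (connectedComponentIn_subset F x) fun y hy => ?_
      by_contra hyA
      have hsub := (connectedComponentIn_subset F x).trans hAB
      obtain ⟨z, hz, hzA, hzB⟩ := isPreconnected_connectedComponentIn A B hA hB hsub
        ⟨x, mem_connectedComponentIn hxF, hxA⟩ ⟨y, hy, (hsub hy).resolve_left hyA⟩
      exact hdisj z (connectedComponentIn_subset F x hz) hzA hzB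
    · exact (isPreconnected_range hf.continuous).subset_connectedComponentIn
        (hrange ▸ ⟨hxF, hxA⟩) (hrange ▸ inter_subset_left)
  rw [heq]
  exact ⟨inferInstance, inferInstance,
    ⟨hf.toHomeomorph.symm.toOpenPartialHomeomorph.singletonChartedSpace rfl⟩⟩

instance OpenCone.instUniqueOfIsEmpty {L : Type*} [IsEmpty L] : Unique (OpenCone L) where
  default := OpenCone.vertex L
  uniq := by
    rintro ⟨⟨x, -⟩ | ⟨⟩⟩
    · exact isEmptyElim x
    · rfl

/-- The open unit ball, as a subset of the closed unit ball. -/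
def openUnitBall (V : Type*) [NormedAddCommGroup V] : Set (Metric.closedBall (0 : V) 1) :=
  {x | ‖(x : V)‖ < 1}

theorem isOpen_openUnitBall (V : Type*) [NormedAddCommGroup V] : IsOpen (openUnitBall V) :=
  isOpen_lt (by fun_prop) continuous_const

theorem dense_openUnitBall (V : Type*) [NormedAddCommGroup V] [NormedSpace ℝ V] :
    Dense (openUnitBall V) := by
  refine Subtype.dense_iff.2 ?_
  refine (closure_ball (0 : V) one_ne_zero).ge.trans (closure_mono fun x hx => ?_)
  rw [mem_ball_zero_iff] at hx
  exact ⟨⟨x, mem_closedBall_zero_iff.2 hx.le⟩, hx, rfl⟩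

/-- The open unit ball of a finite-dimensional space is homeomorphic to the whole space. -/
noncomputable def openUnitBallHomeomorph (V : Type*) [NormedAddCommGroup V] [NormedSpace ℝ V] :
    openUnitBall V ≃ₜ V :=
  Homeomorph.trans
    { toFun := fun x => (⟨x, mem_ball_zero_iff.2 x.2⟩ : Metric.ball (0 : V) 1)
      invFun := fun x => ⟨⟨x, Metric.ball_subset_closedBall x.2⟩, mem_ball_zero_iff.1 x.2⟩
      left_inv := fun _ => rfl
      right_inv := fun _ => rfl
      continuous_toFun := by fun_prop
      continuous_invFun := by fun_prop }
    Homeomorph.unitBall.symm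

/-! ### Strata of the dual filtration -/

section Filtration

variable {P : Type*} [PartialOrder P] [Fintype P] {n : ℕ}

/-- The filtration of the closed unit ball dual to a conical triangulation. -/
def dualFiltration (b : P → EuclideanSpace ℝ (Fin n)) (i : ℤ) :
    Set (Metric.closedBall (0 : EuclideanSpace ℝ (Fin n)) 1) :=
  {x | i = n ∨ i < n ∧ ‖(x : EuclideanSpace ℝ (Fin n))‖ = 1 ∧
    ∀ τ, chainCoord b x τ ≠ 0 → (n : ℤ) - Module.finrank ℝ (coneSpan b τ) ≤ i}

variable {b : P → EuclideanSpace ℝ (Fin n)}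

theorem dualFiltration_self : dualFiltration b n = univ :=
  eq_univ_of_forall fun _ => Or.inl rfl

theorem mem_dualFiltration_of_lt {i : ℤ} (hi : i < n)
    {x : Metric.closedBall (0 : EuclideanSpace ℝ (Fin n)) 1} :
    x ∈ dualFiltration b i ↔ ‖(x : EuclideanSpace ℝ (Fin n))‖ = 1 ∧
      ∀ τ, chainCoord b x τ ≠ 0 → (n : ℤ) - Module.finrank ℝ (coneSpan b τ) ≤ i :=
  ⟨fun h => (h.resolve_left hi.ne).2, fun h => Or.inr ⟨hi, h⟩⟩

theorem dualFiltration_mono {i j : ℤ} (hij : i ≤ j) (hj : j ≤ n) :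
    dualFiltration b i ⊆ dualFiltration b j := by
  rintro x hx
  rcases eq_or_lt_of_le hj with h | h
  · exact Or.inl h
  · rw [mem_dualFiltration_of_lt (hij.trans_lt h)] at hx
    rw [mem_dualFiltration_of_lt h]
    exact ⟨hx.1, fun τ hτ => (hx.2 τ hτ).trans hij⟩

variable (hb : IsConicalTriangulation b)
include hb

theorem isClosed_dualFiltration {i : ℤ} (hi : i ≤ n) : IsClosed (dualFiltration b i) := by
  rcases eq_or_lt_of_le hi with rfl | h
  · rw [dualFiltration_self]; exact isClosed_univ
  · have : dualFiltration b i =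
        {x : Metric.closedBall (0 : EuclideanSpace ℝ (Fin n)) 1 |
          ‖(x : EuclideanSpace ℝ (Fin n))‖ = 1} ∩ ⋂ τ, ⋂ (_ : ¬ (n : ℤ) - Module.finrank ℝ (coneSpan b τ) ≤ i),
          {x | chainCoord b x τ = 0} := by
      ext x
      rw [mem_dualFiltration_of_lt h]
      simp only [mem_inter_iff, mem_iInter, mem_ofPred_eq]
      exact and_congr_right fun _ => forall_congr' fun τ => not_imp_comm
    rw [this]
    refine (isClosed_eq (by fun_prop) continuous_const).inter
      (isClosed_iInter fun τ => isClosed_iInter fun _ => isClosed_eq ?_ continuous_const)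
    exact (continuous_apply τ).comp
      ((continuous_chainCoord hb.bijOn).comp continuous_subtype_val)

theorem dualFiltration_of_neg {i : ℤ} (hi : i < 0) : dualFiltration b i = ∅ := by
  refine eq_empty_of_forall_notMem fun x hx => ?_
  rw [mem_dualFiltration_of_lt (by omega)] at hx
  have hx0 : (x : EuclideanSpace ℝ (Fin n)) ≠ 0 := fun h0 => by simp [h0] at hx
  obtain ⟨τ, hτ⟩ := exists_chainCoord_ne_zero hb.bijOn hx0
  have h1 := hx.2 τ hτ
  have h2 := (coneSpan b τ).finrank_le
  rw [finrank_euclideanSpace_fin] at h2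
  omega

/-- Cones in the index set have dimension at least 1, so the whole sphere lies in the `(n -
1)`-skeleton. -/
theorem dualFiltration_top_diff :
    dualFiltration b n \ dualFiltration b (n - 1) = openUnitBall (EuclideanSpace ℝ (Fin n)) := by
  ext x
  rw [dualFiltration_self, mem_sdiff, mem_dualFiltration_of_lt (by omega)]
  have hx : ‖(x : EuclideanSpace ℝ (Fin n))‖ ≤ 1 := mem_closedBall_zero_iff.1 x.2
  constructor
  · rintro ⟨-, h⟩
    refine lt_of_le_of_ne hx fun h1 => h ⟨h1, fun τ _ => ?_⟩
    have := hb.finrank_coneSpan_pos τ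
    omega
  · intro h
    exact ⟨mem_univ x, fun h1 => (ne_of_lt h) h1.1⟩

/-- A point of a lower stratum lies in the open star of a unique element of complementary
dimension, and this is the least element of the support of its coordinates. -/
theorem exists_mem_openStar_of_mem_diff {k : ℕ} (hk : k < n)
    {x : Metric.closedBall (0 : EuclideanSpace ℝ (Fin n)) 1}
    (hx : x ∈ dualFiltration b k \ dualFiltration b (k - 1)) :
    ∃ σ, x ∈ openStar b σ ∧ k + Module.finrank ℝ (coneSpan b σ) = n := by
  obtain ⟨h1, h2⟩ := hx
  rw [mem_dualFiltration_of_lt (by omega)] at h1 h2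
  have h3 : ∃ σ, chainCoord b x σ ≠ 0 ∧
      ¬ ((n : ℤ) - Module.finrank ℝ (coneSpan b σ) ≤ k - 1) := by
    by_contra! h3
    exact h2 ⟨h1.1, h3⟩
  obtain ⟨σ, hσ, hdim⟩ := h3
  have h4 := h1.2 σ hσ
  exact ⟨σ, lt_of_le_of_ne (chainCoord_nonneg hb.bijOn _ _) hσ.symm, by omega⟩

/-- The support is a chain through `σ` with strictly increasing dimensions, so the bound on
codimension says precisely that nothing below `σ` occurs. -/
theorem mem_diff_iff_of_mem_openStar {k : ℕ} (hk : k < n) {σ : P}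
    (hσ : k + Module.finrank ℝ (coneSpan b σ) = n)
    {x : Metric.closedBall (0 : EuclideanSpace ℝ (Fin n)) 1} (hx : x ∈ openStar b σ) :
    x ∈ dualFiltration b k \ dualFiltration b (k - 1) ↔
      ‖(x : EuclideanSpace ℝ (Fin n))‖ = 1 ∧ ∀ τ < σ, chainCoord b x τ = 0 := by
  have hσ0 : chainCoord b x σ ≠ 0 := ne_of_gt (show 0 < chainCoord b x σ from hx)
  rw [mem_sdiff, mem_dualFiltration_of_lt (by omega), mem_dualFiltration_of_lt (by omega)]
  constructor
  · rintro ⟨⟨h1, h2⟩, -⟩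
    refine ⟨h1, fun τ hτ => ?_⟩
    by_contra h0
    have h3 := h2 τ h0
    have h4 := hb.finrank_coneSpan_lt hτ
    omega
  · rintro ⟨h1, h2⟩
    refine ⟨⟨h1, fun τ hτ => ?_⟩, fun h3 => ?_⟩
    · have h3 : σ ≤ τ := by
        rcases chainCoord_total hb.bijOn _ hσ0 hτ with h | h
        · exact h
        · rcases eq_or_lt_of_le h with rfl | h
          · exact le_rfl
          · exact absurd (h2 τ h) hτ
      have h4 := Submodule.finrank_mono (coneSpan_mono (b := b) h3)
      omega
    · have := h3.2 σ hσ0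
      omega

end Filtration

/-! ### Charts at points of the lower strata -/

section LocalStructure

variable {P : Type*} [PartialOrder P] [Fintype P] {n e k : ℕ} {b : P → EuclideanSpace ℝ (Fin n)}
  (hb : IsConicalTriangulation b) {σ : P} [Fintype (Iio σ)] [Fintype (Ioi σ)]
  (hn : e + k + 1 = n) (hσ : Module.finrank ℝ (coneSpan b σ) = e + 1)
  {f : EuclideanSpace ℝ (Fin n) →ₗ[ℝ] EuclideanSpace ℝ (Fin e)}
  (hker : ∀ v ∈ coneSpan b σ, f v = 0 → ∃ s : ℝ, v = s • b σ)
  (hf : IsConicalTriangulation (fun τ : Iio σ => f (b τ)))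
  {d : Ioi σ → EuclideanSpace ℝ (Fin k)}
  (hd : BijOn (conicalSum d) (chainCone (Ioi σ)) univ)
include hb hn hσ hf hd

-- Below `σ`, the coordinates of the link component are those of `q` up to a positive factor, and
-- codimensions in `ℝ^n` and `ℝ^e` differ by `k + 1`. Lying on the sphere means `s = 0`, which for a
-- point other than the cone vertex puts the corresponding link point on the sphere of `B^e`.
include hker in
theorem mem_dualFiltration_iff_mem_subcone {j : ℤ} (hj : -1 ≤ j) (hje : j ≤ e)
    (q : openStar b σ) :
    (q : Metric.closedBall (0 : EuclideanSpace ℝ (Fin n)) 1) ∈ dualFiltration b (k + j + 1) ↔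
      openConeBallHomeomorph.symm (openStarHomeomorph hb.bijOn σ hf.bijOn hd q).2 ∈
        OpenCone.subcone (dualFiltration (fun τ : Iio σ => f (b τ)) j) := by
  obtain ⟨q, hq⟩ := q
  set c : Iio σ → EuclideanSpace ℝ (Fin e) := fun τ => f (b τ) with hc
  have hqσ : 0 < chainCoord b q σ := hq
  have hq0 : 0 < ‖(q : EuclideanSpace ℝ (Fin n))‖ :=
    norm_pos_iff.2 (ne_zero_of_mem_openStar hb.bijOn hq)
  have hq1 : ‖(q : EuclideanSpace ℝ (Fin n))‖ ≤ 1 := mem_closedBall_zero_iff.1 q.2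
  have hdim (τ : Iio σ) : Module.finrank ℝ (coneSpan c τ) =
      Module.finrank ℝ (coneSpan b (τ : P)) := hb.finrank_coneSpan_link f hker τ
  generalize hψ : (openStarHomeomorph hb.bijOn σ hf.bijOn hd ⟨q, hq⟩).2 = ψ
  obtain ⟨v, s⟩ := ψ
  have hv : v = conicalSum c (fun τ => (chainCoord b q σ)⁻¹ * chainCoord b q τ) :=
    (congr_arg Prod.fst hψ).symm
  have hs : (s : ℝ) = ‖(q : EuclideanSpace ℝ (Fin n))‖⁻¹ - 1 :=
    (congr_arg (fun p => (p.2 : ℝ)) hψ).symm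
  have hs0 : (0 : ℝ) ≤ s := s.2
  have hs_iff : (s : ℝ) = 0 ↔ ‖(q : EuclideanSpace ℝ (Fin n))‖ = 1 := by
    rw [hs, sub_eq_zero, inv_eq_one]
  have hcv (τ : Iio σ) : chainCoord c v τ = (chainCoord b q σ)⁻¹ * chainCoord b q τ := by
    rw [hv, chainCoord_conicalSum hf.bijOn]
    exact smul_mem_chainCone (comp_val_mem_chainCone (chainCoord_mem hb.bijOn _) _)
      (inv_nonneg.2 hqσ.le)
  have hcv0 (τ : Iio σ) : chainCoord c v τ ≠ 0 ↔ chainCoord b q τ ≠ 0 := by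
    rw [hcv]; simp [hqσ.ne']
  -- Only elements below `σ` need checking: the others in the support have codimension at most `k`,
  -- and `-1 ≤ j`.
  have hdims (h : ∀ τ : Iio σ, chainCoord b q τ ≠ 0 →
      (e : ℤ) - Module.finrank ℝ (coneSpan b (τ : P)) ≤ j) (τ : P) (hτ : chainCoord b q τ ≠ 0) :
      (n : ℤ) - Module.finrank ℝ (coneSpan b τ) ≤ k + j + 1 := by
    by_cases hlt : τ < σ
    · have := h ⟨τ, hlt⟩ hτ
      dsimp only at this
      omega
    · have hle : σ ≤ τ := by
        rcases chainCoord_total hb.bijOn _ hqσ.ne' hτ with h | h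
        · exact h
        · rcases eq_or_lt_of_le h with rfl | h
          · exact le_rfl
          · exact absurd h hlt
      have := Submodule.finrank_mono (coneSpan_mono (b := b) hle)
      omega
  rw [openConeBallHomeomorph_symm_mem_subcone]
  have hN : 0 ≤ ‖v‖ + (s : ℝ) := by positivity
  have hcx (τ : Iio σ) : chainCoord c ((‖v‖ + (s : ℝ))⁻¹ • v) τ =
      (‖v‖ + (s : ℝ))⁻¹ * chainCoord c v τ := by
    rw [chainCoord_smul hf.bijOn (inv_nonneg.2 hN)]; rfl
  have hnorm : ‖(‖v‖ + (s : ℝ))⁻¹ • v‖ = (‖v‖ + (s : ℝ))⁻¹ * ‖v‖ := by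
    rw [norm_smul, norm_inv, Real.norm_of_nonneg hN]
  -- For `j = e` both filtration steps are the whole space and impose no condition.
  rcases eq_or_lt_of_le hje with hj' | hj'
  · refine iff_of_true (Or.inl (by omega)) (Or.inr ⟨⟨(‖v‖ + (s : ℝ))⁻¹ • v, ?_⟩, Or.inl hj', rfl⟩)
    rw [mem_closedBall_zero_iff, hnorm]
    exact inv_mul_le_one_of_le₀ (by linarith) hN
  rw [mem_dualFiltration_of_lt (by omega)]
  constructor
  · rintro ⟨h1, h2⟩
    have hs' := hs_iff.2 h1
    by_cases h0 : ‖v‖ + (s : ℝ) = 0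
    · exact Or.inl h0
    · have hx1 : ‖(‖v‖ + (s : ℝ))⁻¹ • v‖ = 1 := by
        rw [hnorm, ← add_zero ‖v‖, hs', add_zero, inv_mul_cancel₀ (by simpa [hs'] using h0)]
      refine Or.inr ⟨⟨(‖v‖ + (s : ℝ))⁻¹ • v, mem_closedBall_zero_iff.2 hx1.le⟩, ?_, rfl⟩
      refine (mem_dualFiltration_of_lt hj').2 ⟨hx1, fun τ hτ => ?_⟩
      rw [hcx] at hτ
      have := h2 τ ((hcv0 τ).1 (right_ne_zero_of_mul hτ))
      rw [hdim]
      omega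
  · rintro (h0 | ⟨x, hx, hxv⟩)
    · have hs' : (s : ℝ) = 0 := by linarith [norm_nonneg v]
      have hv0 : v = 0 := norm_eq_zero.1 (by linarith [norm_nonneg v])
      refine ⟨hs_iff.1 hs', hdims fun τ hτ => absurd ?_ ((hcv0 τ).2 hτ)⟩
      rw [hv0, chainCoord_zero hf.bijOn, Pi.zero_apply]
    · rw [mem_dualFiltration_of_lt hj', hxv, hnorm] at hx
      have hN0 : ‖v‖ + (s : ℝ) ≠ 0 := by
        intro h0
        simp [h0] at hx
      have hs' : (s : ℝ) = 0 := by
        have := hx.1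
        rw [inv_mul_eq_one₀ hN0] at this
        linarith
      refine ⟨hs_iff.1 hs', hdims fun τ hτ => ?_⟩
      rw [← hdim]
      refine hx.2 τ ?_
      rw [hcx]
      exact mul_ne_zero (inv_ne_zero hN0) ((hcv0 τ).2 hτ)

/-- In the chart the stratum is the slice `ℝ^k × {(0, 0)}`. The rest of it is covered by open stars
of other elements of the same dimension, disjoint from that of `σ` because comparable distinct
elements have different dimensions. -/
theorem isTopologicalManifold_connectedComponentIn_dualFiltration
    {x : Metric.closedBall (0 : EuclideanSpace ℝ (Fin n)) 1} (hx : x ∈ openStar b σ)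
    (hxk : x ∈ dualFiltration b k \ dualFiltration b (k - 1)) :
    IsTopologicalManifold k
      (connectedComponentIn (dualFiltration b k \ dualFiltration b (k - 1)) x) := by
  let ψ := openStarHomeomorph hb.bijOn σ hf.bijOn hd
  have hemb : Topology.IsEmbedding fun u : EuclideanSpace ℝ (Fin k) =>
      (ψ.symm (u, (0, ⟨0, self_mem_Ici⟩)) : Metric.closedBall (0 : EuclideanSpace ℝ (Fin n)) 1) :=
    Topology.IsEmbedding.subtypeVal.comp
      (ψ.symm.isEmbedding.comp (Topology.IsEmbedding.of_leftInverse (f := Prod.fst)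
        (fun _ => rfl) continuous_fst (by fun_prop)))
  refine isTopologicalManifold_connectedComponentIn hemb (isOpen_openStar hb.bijOn σ)
    (B := ⋃ τ, ⋃ (_ : τ ≠ σ ∧ k + Module.finrank ℝ (coneSpan b τ) = n), openStar b τ)
    (isOpen_iUnion fun τ => isOpen_iUnion fun _ => isOpen_openStar hb.bijOn τ) ?_ ?_ ?_ hxk hx
  · intro y hy
    obtain ⟨τ, hτ, hdim⟩ := exists_mem_openStar_of_mem_diff hb (by omega) hy
    by_cases h : τ = σ
    · exact Or.inl (h ▸ hτ)
    · exact Or.inr (mem_iUnion₂.2 ⟨τ, ⟨h, hdim⟩, hτ⟩)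
  · intro y _ hyσ hyB
    obtain ⟨τ, ⟨hne, hdim⟩, hτ⟩ := mem_iUnion₂.1 hyB
    rcases chainCoord_total hb.bijOn _ (show 0 < chainCoord b y τ from hτ).ne'
      (show 0 < chainCoord b y σ from hyσ).ne' with h | h
    · have := hb.finrank_coneSpan_lt (lt_of_le_of_ne h hne)
      omega
    · have := hb.finrank_coneSpan_lt (lt_of_le_of_ne h hne.symm)
      omega
  · have hiff (q : openStar b σ) : (q : Metric.closedBall (0 : EuclideanSpace ℝ (Fin n)) 1) ∈
        dualFiltration b k \ dualFiltration b (k - 1) ↔ (ψ q).2 = (0, ⟨0, self_mem_Ici⟩) := by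
      have hq0 : 0 < ‖((q : Metric.closedBall (0 : EuclideanSpace ℝ (Fin n)) 1) :
        EuclideanSpace ℝ (Fin n))‖ := norm_pos_iff.2 (ne_zero_of_mem_openStar hb.bijOn q.2)
      have hqσ : 0 < chainCoord b q σ := q.2
      rw [mem_diff_iff_of_mem_openStar hb (by omega) (by omega) q.2, Prod.ext_iff, Subtype.ext_iff,
        and_comm]
      refine and_congr ?_ ?_
      · change _ ↔ conicalSum (fun τ : Iio σ => f (b τ))
          (fun τ => (chainCoord b q σ)⁻¹ * chainCoord b q τ) = 0
        constructor
        · intro h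
          rw [show (fun τ : Iio σ => (chainCoord b q σ)⁻¹ * chainCoord b q τ) = 0 from
            funext fun τ => by rw [h τ τ.2, mul_zero, Pi.zero_apply], map_zero]
        · intro h τ hτ
          have h1 := hf.bijOn.injOn (smul_mem_chainCone (comp_val_mem_chainCone
            (chainCoord_mem hb.bijOn _) _) (inv_nonneg.2 hqσ.le)) zero_mem_chainCone
              (h.trans (map_zero _).symm)
          have h2 : (chainCoord b q σ)⁻¹ * chainCoord b q τ = 0 := congr_fun h1 ⟨τ, hτ⟩
          exact (mul_eq_zero.1 h2).resolve_left (inv_ne_zero hqσ.ne')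
      · change _ ↔ ‖((q : Metric.closedBall (0 : EuclideanSpace ℝ (Fin n)) 1) :
          EuclideanSpace ℝ (Fin n))‖⁻¹ - 1 = 0
        rw [sub_eq_zero, inv_eq_one]
    ext y
    constructor
    · rintro ⟨u, rfl⟩
      refine ⟨(hiff _).2 ?_, (ψ.symm _).2⟩
      rw [ψ.apply_symm_apply]
    · rintro ⟨hy, hyσ⟩
      refine ⟨(ψ ⟨y, hyσ⟩).1, ?_⟩
      have h1 : ψ ⟨y, hyσ⟩ = ((ψ ⟨y, hyσ⟩).1, (0, ⟨0, self_mem_Ici⟩)) :=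
        Prod.ext rfl ((hiff ⟨y, hyσ⟩).1 hy)
      dsimp only
      rw [← h1, ψ.symm_apply_apply]

end LocalStructure

/-! ### Induction over links -/

theorem contractibleSpace_univ (k : ℕ) :
    ContractibleSpace (univ : Set (EuclideanSpace ℝ (Fin k))) :=
  (Homeomorph.Set.univ _).contractibleSpace

/-- The poset and the vectors are quantified inside the induction on `n`, since the link replaces
them by `Iio σ` and projected vectors. -/
theorem IsConicalTriangulation.isTopologicalStratifiedPseudomanifold (n : ℕ) :
    ∀ {P : Type} [PartialOrder P] [Fintype P] {b : P → EuclideanSpace ℝ (Fin n)},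
      IsConicalTriangulation b → IsTopologicalStratifiedPseudomanifold n
        (Metric.closedBall (0 : EuclideanSpace ℝ (Fin n)) 1) (dualFiltration b) := by
  induction n using Nat.strong_induction_on with
  | h n ih =>
  classical
  intro P _ _ b hb
  rw [IsTopologicalStratifiedPseudomanifold]
  refine ⟨inferInstance, fun i hi => dualFiltration_of_neg hb hi, dualFiltration_self, ?_, ?_⟩
  · rintro rfl
    have : Subsingleton (EuclideanSpace ℝ (Fin 0)) := inferInstance
    infer_instance
  intro hn0
  refine ⟨fun i hi => isClosed_dualFiltration hb hi, fun i j hij hj => dualFiltration_mono hij hj,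
    ?_, ?_, ?_, ?_⟩
  · intro h
    have h0 : (⟨0, by simp⟩ : Metric.closedBall (0 : EuclideanSpace ℝ (Fin n)) 1) ∈
      dualFiltration b (n - 1) := h ▸ mem_univ _
    rw [mem_dualFiltration_of_lt (by omega)] at h0
    simp at h0
  · intro k hk x hx
    rcases eq_or_lt_of_le hk with rfl | hk
    · rw [dualFiltration_top_diff hb] at hx ⊢
      -- The open ball is connected, so the separation is trivial.
      refine isTopologicalManifold_connectedComponentIn (f := fun y =>
        ((openUnitBallHomeomorph (EuclideanSpace ℝ (Fin k))).symm y :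
          Metric.closedBall (0 : EuclideanSpace ℝ (Fin k)) 1))
        (Topology.IsEmbedding.subtypeVal.comp (Homeomorph.isEmbedding _)) isOpen_univ isOpen_empty
        (by simp) (by simp) ?_ hx (mem_univ x)
      rw [inter_univ]
      ext y
      constructor
      · rintro ⟨z, rfl⟩
        exact Subtype.property _
      · intro hy
        exact ⟨openUnitBallHomeomorph _ ⟨y, hy⟩, by simp⟩
    · obtain ⟨σ, hσ, hdim⟩ := exists_mem_openStar_of_mem_diff hb hk hx
      obtain ⟨e, he⟩ : ∃ e, Module.finrank ℝ (coneSpan b σ) = e + 1 :=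
        ⟨_, (Nat.succ_pred_eq_of_pos (hb.finrank_coneSpan_pos σ)).symm⟩
      obtain ⟨f, hfσ, hker, hsurj⟩ := hb.exists_link_projection he
      obtain ⟨g, hg, hgsurj⟩ := exists_star_projection (coneSpan b σ) (k := k)
        (by rw [finrank_euclideanSpace_fin, hdim])
      exact isTopologicalManifold_connectedComponentIn_dualFiltration hb (by omega) he
        (hb.link σ f hfσ hker hsurj) (hb.bijOn_star σ g hg hgsurj) hσ hx
  · rw [dualFiltration_top_diff hb]
    exact dense_openUnitBall _
  · intro k hk p hp
    rcases eq_or_lt_of_le hk with rfl | hk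
    · rw [dualFiltration_top_diff hb] at hp
      refine ⟨openUnitBall _, univ, Empty, inferInstance, inferInstance, inferInstance,
        fun _ => ∅, ((openUnitBallHomeomorph _).trans (Homeomorph.Set.univ _).symm).trans
          (Homeomorph.prodUnique _ _).symm, isOpen_openUnitBall _, hp, isOpen_univ,
        contractibleSpace_univ k, Or.inl ⟨rfl, inferInstance⟩, fun j hj hj' q => ?_⟩
      -- The bounds force `j = -1`: the full skeleton on one side, the one-point cone on the other.
      refine iff_of_true ?_ (Or.inl (Subsingleton.elim _ _))
      rw [show (k : ℤ) + j + 1 = k by omega, dualFiltration_self]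
      exact mem_univ _
    · obtain ⟨σ, hσ, hdim⟩ := exists_mem_openStar_of_mem_diff hb hk hp
      obtain ⟨e, he⟩ : ∃ e, Module.finrank ℝ (coneSpan b σ) = e + 1 :=
        ⟨_, (Nat.succ_pred_eq_of_pos (hb.finrank_coneSpan_pos σ)).symm⟩
      obtain ⟨f, hfσ, hker, hsurj⟩ := hb.exists_link_projection he
      obtain ⟨g, hg, hgsurj⟩ := exists_star_projection (coneSpan b σ) (k := k)
        (by rw [finrank_euclideanSpace_fin, hdim])
      have hf := hb.link σ f hfσ hker hsurj
      have hd := hb.bijOn_star σ g hg hgsurj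
      refine ⟨openStar b σ, univ, Metric.closedBall (0 : EuclideanSpace ℝ (Fin e)) 1,
        inferInstance, inferInstance, inferInstance, dualFiltration fun τ : Iio σ => f (b τ),
        (openStarHomeomorph hb.bijOn σ hf.bijOn hd).trans
          ((Homeomorph.Set.univ _).symm.prodCongr openConeBallHomeomorph.symm),
        isOpen_openStar hb.bijOn σ, hσ, isOpen_univ, contractibleSpace_univ k,
        Or.inr ⟨e, by omega, ih e (by omega) hf⟩, fun j hj hj' q => ?_⟩
      exact mem_dualFiltration_iff_mem_subcone hb (by omega) he hker hf hd hj (by omega) q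

/-! ### Polyhedral cones -/

section PolyhedralCone

variable {E : Type*} [NormedAddCommGroup E] [NormedSpace ℝ E]

theorem PointedCone.mem_hull_range_iff {ι : Type*} [Fintype ι] {g : ι → E} {x : E} :
    x ∈ PointedCone.hull ℝ (range g) ↔
      ∃ c : ι → ℝ, (∀ i, 0 ≤ c i) ∧ Fintype.linearCombination ℝ g c = x := by
  rw [Submodule.mem_span_range_iff_exists_fun]
  constructor
  · rintro ⟨c, rfl⟩
    exact ⟨fun i => c i, fun i => (c i).2, rfl⟩
  · rintro ⟨c, hc, rfl⟩
    exact ⟨fun i => ⟨c i, hc i⟩, rfl⟩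

/-- With zero generators discarded, salience lets a nonnegative combination vanish only if all its
coefficients do. The orthant of coefficients then maps properly, so its image is closed. -/
theorem PointedCone.isClosed_of_fg_of_salient [FiniteDimensional ℝ E] {σ : PointedCone ℝ E}
    (hfg : σ.FG) (hsal : (σ : ConvexCone ℝ E).Salient) : IsClosed (σ : Set E) := by
  classical
  obtain ⟨s, rfl⟩ := hfg
  let g : {x // x ∈ s.erase 0} → E := Subtype.val
  have hspan : Submodule.span {c : ℝ // 0 ≤ c} (s : Set E) = PointedCone.hull ℝ (range g) := by
    apply le_antisymm
    · refine Submodule.span_le.2 fun x hx => ?_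
      by_cases h0 : x = 0
      · rw [h0]; exact zero_mem _
      · exact Submodule.subset_span ⟨⟨x, Finset.mem_erase.2 ⟨h0, hx⟩⟩, rfl⟩
    · refine Submodule.span_mono ?_
      rintro _ ⟨x, rfl⟩
      exact Finset.mem_of_mem_erase x.2
  let K : Set ({x // x ∈ s.erase 0} → ℝ) := {c | ∀ i, 0 ≤ c i}
  have hK : IsClosed K := by
    have : K = ⋂ i, {c | 0 ≤ c i} := by ext; simp [K]
    rw [this]
    exact isClosed_iInter fun i => isClosed_le continuous_const (continuous_apply i)
  have hproper := isProperMap_restrict_of_isClosed_cone hK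
    (fun c hc t ht i => mul_nonneg ht (hc i)) (Fintype.linearCombination ℝ g) (by
      intro c hc h0
      ext i
      by_contra hi
      have hi0 : 0 < c i := lt_of_le_of_ne (hc i) (Ne.symm hi)
      have hne : g i ≠ 0 := (Finset.mem_erase.1 i.2).1
      have hmem (j) : g j ∈ PointedCone.hull ℝ (range g) := Submodule.subset_span ⟨j, rfl⟩
      rw [hspan] at hsal
      refine hsal (g i) (hmem i) hne ?_
      rw [Fintype.linearCombination_apply, ← Finset.add_sum_erase _ _ (Finset.mem_univ i)] at h0
      have h1 : -g i = (c i)⁻¹ • ∑ j ∈ Finset.univ.erase i, c j • g j := by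
        rw [← neg_eq_of_add_eq_zero_right h0, smul_neg, inv_smul_smul₀ hi0.ne']
      change -g i ∈ PointedCone.hull ℝ (range g)
      rw [h1]
      exact PointedCone.smul_mem _ (by positivity)
        (sum_mem fun j _ => PointedCone.smul_mem _ (hc j) (hmem j)))
  have himage : ((Submodule.span {c : ℝ // 0 ≤ c} (s : Set E) : PointedCone ℝ E) : Set E) =
      range (K.domRestrict (Fintype.linearCombination ℝ g)) := by
    ext x
    rw [hspan]
    refine PointedCone.mem_hull_range_iff.trans ?_
    exact ⟨fun ⟨c, hc, h⟩ => ⟨⟨c, hc⟩, h⟩, fun ⟨c, h⟩ => ⟨c, c.2, h⟩⟩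
  rw [himage]
  exact hproper.isClosedMap.isClosed_range

/-- The admissible `t` form a closed set. If it were unbounded, `t⁻¹ • x - v ∈ σ` would tend to
`-v`, contradicting salience. -/
theorem PointedCone.exists_maximal_sub_smul_mem {σ : PointedCone ℝ E}
    (hcl : IsClosed (σ : Set E)) (hsal : (σ : ConvexCone ℝ E).Salient) {x v : E} (hx : x ∈ σ)
    (hv : v ∈ σ) (hv0 : v ≠ 0) :
    ∃ t : ℝ, 0 ≤ t ∧ x - t • v ∈ σ ∧ ∀ ε : ℝ, 0 < ε → x - t • v - ε • v ∉ σ := by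
  let A : Set ℝ := {t | 0 ≤ t ∧ x - t • v ∈ σ}
  have hAcl : IsClosed A :=
    (isClosed_le continuous_const continuous_id).inter
      (hcl.preimage (by fun_prop : Continuous fun t : ℝ => x - t • v))
  have h0 : (0 : ℝ) ∈ A := ⟨le_rfl, by simpa using hx⟩
  have hbdd : BddAbove A := by
    by_contra hunb
    refine hsal v hv hv0 ?_
    have hlim : Filter.Tendsto (fun t : ℝ => t⁻¹ • x - v) Filter.atTop (nhds ((0 : ℝ) • x - v)) :=
      (tendsto_inv_atTop_zero.smul_const x).sub_const v
    rw [zero_smul, zero_sub] at hlim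
    refine hcl.mem_of_frequently_of_tendsto (Filter.frequently_atTop.2 fun M => ?_) hlim
    rw [not_bddAbove_iff] at hunb
    obtain ⟨t, ht, hMt⟩ := hunb (max M 0)
    have ht0 : 0 < t := (le_max_right M 0).trans_lt hMt
    refine ⟨t, ((le_max_left M 0).trans_lt hMt).le, ?_⟩
    have h1 := σ.smul_mem (inv_nonneg.2 ht0.le) ht.2
    rwa [smul_sub, inv_smul_smul₀ ht0.ne'] at h1
  have hsup := hAcl.csSup_mem ⟨0, h0⟩ hbdd
  refine ⟨sSup A, hsup.1, hsup.2, fun ε hε hmem => ?_⟩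
  have h1 : sSup A + ε ∈ A := ⟨add_nonneg hsup.1 hε.le, by rwa [add_smul, ← sub_sub]⟩
  linarith [le_csSup hbdd h1]

/-- The smallest face of a cone that contains a given point `y` of it. -/
def PointedCone.minimalFace (σ : PointedCone ℝ E) {y : E} (hy : y ∈ σ) : PointedCone ℝ E where
  carrier := {z | z ∈ σ ∧ ∃ ε : ℝ, 0 < ε ∧ y - ε • z ∈ σ}
  zero_mem' := ⟨zero_mem _, 1, one_pos, by simpa using hy⟩
  add_mem' := by
    rintro z w ⟨hz, ε, hε, hzε⟩ ⟨hw, δ, hδ, hwδ⟩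
    refine ⟨add_mem hz hw, min ε δ / 2, by positivity, ?_⟩
    have h1 := min_le_left ε δ
    have h2 := min_le_right ε δ
    have h3 : y - (min ε δ / 2) • (z + w) = (1 / 2 : ℝ) • (y - ε • z) + (1 / 2 : ℝ) • (y - δ • w) +
        (((ε - min ε δ) / 2) • z + ((δ - min ε δ) / 2) • w) := by module
    rw [h3]
    exact add_mem (add_mem (σ.smul_mem (by norm_num) hzε)
      (σ.smul_mem (by norm_num) hwδ)) (add_mem
        (σ.smul_mem (by linarith) hz) (σ.smul_mem (by linarith) hw))
  smul_mem' := by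
    rintro ⟨c, hc⟩ z ⟨hz, ε, hε, hzε⟩
    -- Division by `c + 1` instead of `c` covers `c = 0` and leaves the surplus `(ε / (c + 1)) • z`,
    -- again in `σ`.
    refine ⟨σ.smul_mem hc hz, ε / (c + 1), by positivity, ?_⟩
    change y - (ε / (c + 1)) • c • z ∈ σ
    have h1 : y - (ε / (c + 1)) • c • z = (y - ε • z) + (ε / (c + 1)) • z := by
      have : ε = ε / (c + 1) * (c + 1) := by field_simp
      nth_rewrite 2 [this]
      module
    rw [h1]
    exact add_mem hzε (σ.smul_mem (by positivity) hz)

theorem PointedCone.mem_minimalFace {σ : PointedCone ℝ E} {y : E} (hy : y ∈ σ) {z : E} :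
    z ∈ σ.minimalFace hy ↔ z ∈ σ ∧ ∃ ε : ℝ, 0 < ε ∧ y - ε • z ∈ σ := Iff.rfl

theorem PointedCone.self_mem_minimalFace {σ : PointedCone ℝ E} {y : E} (hy : y ∈ σ) :
    y ∈ σ.minimalFace hy := ⟨hy, 1, one_pos, by simp⟩

theorem PointedCone.minimalFace_isFaceOf {σ : PointedCone ℝ E} {y : E} (hy : y ∈ σ) :
    (σ.minimalFace hy).IsFaceOf σ where
  le := fun _ hz => hz.1
  mem_of_smul_add_mem := by
    rintro u w a hu hw ha ⟨-, ε, hε, hmem⟩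
    refine ⟨hu, ε * a, by positivity, ?_⟩
    have h1 : y - (ε * a) • u = (y - ε • (a • u + w)) + ε • w := by module
    rw [h1]
    exact add_mem hmem (σ.smul_mem hε.le hw)

theorem PointedCone.exists_add_smul_mem_of_mem_intrinsicInterior {σ : PointedCone ℝ E} {v w : E}
    (hv : v ∈ intrinsicInterior ℝ (σ : Set E)) (hw : w ∈ Submodule.span ℝ (σ : Set E)) :
    ∃ ε : ℝ, 0 < ε ∧ v + ε • w ∈ σ := by
  obtain ⟨y, hy, rfl⟩ := mem_intrinsicInterior.1 hv
  have hdir : w ∈ (affineSpan ℝ (σ : Set E)).direction := by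
    rw [direction_affineSpan, vectorSpan_eq_span_vsub_set_right ℝ (show (0 : E) ∈ (σ : Set E) from
      zero_mem σ)]
    simpa using hw
  have hmem (t : ℝ) : (y : E) + t • w ∈ affineSpan ℝ (σ : Set E) := by
    rw [add_comm]
    exact AffineSubspace.vadd_mem_of_mem_direction (Submodule.smul_mem _ t hdir) y.2
  have hcont : Continuous fun t : ℝ => (⟨(y : E) + t • w, hmem t⟩ : affineSpan ℝ (σ : Set E)) :=
    Continuous.subtype_mk (by fun_prop) _
  have h0 : (⟨(y : E) + (0 : ℝ) • w, hmem 0⟩ : affineSpan ℝ (σ : Set E)) ∈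
      interior ((↑) ⁻¹' (σ : Set E) : Set (affineSpan ℝ (σ : Set E))) := by simpa using hy
  have hev : ∀ᶠ t : ℝ in nhdsWithin 0 (Ioi 0), (y : E) + t • w ∈ σ := by
    refine nhdsWithin_le_nhds ?_
    filter_upwards [hcont.continuousAt.preimage_mem_nhds (isOpen_interior.mem_nhds h0)] with t ht
    have := interior_subset (mem_preimage.1 ht)
    exact this
  obtain ⟨ε, hε, hpos⟩ := (hev.and self_mem_nhdsWithin).exists
  exact ⟨ε, hpos, hε⟩

/-- The segment from any `z ∈ σ` through `v` extends a little beyond `v` inside `σ`. So a positive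
multiple of `v` is a sum with `z` as a summand, and the face property gives `z ∈ F`. -/
theorem PointedCone.IsFaceOf.eq_of_mem_intrinsicInterior {F σ : PointedCone ℝ E}
    (hF : F.IsFaceOf σ) {v : E} (hv : v ∈ intrinsicInterior ℝ (σ : Set E)) (hvF : v ∈ F) :
    F = σ := by
  refine le_antisymm hF.le fun z hz => ?_
  obtain ⟨ε, hε, hmem⟩ := PointedCone.exists_add_smul_mem_of_mem_intrinsicInterior hv
    (w := v - z) (sub_mem (Submodule.subset_span (hF.le hvF)) (Submodule.subset_span hz))
  refine hF.mem_of_smul_add_mem hz hmem hε ?_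
  have : ε • z + (v + ε • (v - z)) = (1 + ε) • v := by module
  rw [this]
  exact F.smul_mem (by positivity) hvF

theorem PointedCone.bot_isFaceOf_of_salient {σ : PointedCone ℝ E}
    (hsal : (σ : ConvexCone ℝ E).Salient) : (⊥ : PointedCone ℝ E).IsFaceOf σ where
  le := bot_le
  mem_of_smul_add_mem := by
    intro x y a hx hy ha h0
    rw [Submodule.mem_bot] at h0 ⊢
    by_contra hx0
    refine hsal x hx hx0 ?_
    have h1 : -x = a⁻¹ • y := by
      rw [← neg_eq_of_add_eq_zero_right h0, smul_neg, inv_smul_smul₀ ha.ne']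
    change -x ∈ σ
    rw [h1]
    exact σ.smul_mem (by positivity) hy

end PolyhedralCone

/-! ### The barycentric subdivision of a complete fan -/

section Fan

variable {n : ℕ} {S : Set (PointedCone ℝ (EuclideanSpace ℝ (Fin n)))}
  {b : PointedCone ℝ (EuclideanSpace ℝ (Fin n)) → EuclideanSpace ℝ (Fin n)}

/-- The nonzero cones of a fan. -/
abbrev NonzeroCone (S : Set (PointedCone ℝ (EuclideanSpace ℝ (Fin n)))) : Type :=
  {σ : PointedCone ℝ (EuclideanSpace ℝ (Fin n)) // σ ∈ S ∧ σ ≠ ⊥}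

theorem IsCompleteFan.isFaceOf (hS : IsCompleteFan S) {σ τ} (hσ : σ ∈ S) (hτ : τ ∈ S)
    (hle : τ ≤ σ) : τ.IsFaceOf σ := by
  have := (hS.inter_isFace σ hσ τ hτ).1
  rwa [inf_eq_right.2 hle] at this

theorem IsCompleteFan.bot_mem (hS : IsCompleteFan S) : ⊥ ∈ S := by
  obtain ⟨σ, hσ, -⟩ := hS.complete 0
  exact hS.face_mem σ hσ _ (PointedCone.bot_isFaceOf_of_salient (hS.stronglyConvex σ hσ))

theorem IsBarycenterChoice.mem (hb : IsBarycenterChoice S b) (σ : NonzeroCone S) : b σ ∈ σ.1 :=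
  intrinsicInterior_subset (hb σ σ.2.1 σ.2.2).2

theorem IsBarycenterChoice.eq_of_isFaceOf (hb : IsBarycenterChoice S b) (σ : NonzeroCone S) {F}
    (hF : F.IsFaceOf σ.1) (h : b σ ∈ F) : F = σ.1 :=
  hF.eq_of_mem_intrinsicInterior (hb σ σ.2.1 σ.2.2).2 h

variable [Fintype (NonzeroCone S)]

theorem conicalSum_update {a : NonzeroCone S → ℝ} [DecidableEq (NonzeroCone S)]
    (σ : NonzeroCone S) :
    conicalSum (fun τ : NonzeroCone S => b τ) (Function.update a σ 0) =
      conicalSum (fun τ : NonzeroCone S => b τ) a - a σ • b σ := by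
  have : Function.update a σ 0 = a - Pi.single σ (a σ) := by
    ext τ
    by_cases h : τ = σ
    · subst h; simp
    · simp [h]
  rw [this, map_sub, conicalSum_single]

theorem conicalSum_barycenter_mem (hb : IsBarycenterChoice S b)
    {σ : PointedCone ℝ (EuclideanSpace ℝ (Fin n))}
    {a : NonzeroCone S → ℝ} (ha : ∀ τ, 0 ≤ a τ) (hsupp : ∀ τ, a τ ≠ 0 → τ.1 ≤ σ) :
    conicalSum (fun τ : NonzeroCone S => b τ) a ∈ σ := by
  rw [Fintype.linearCombination_apply]
  refine sum_mem fun τ _ => ?_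
  by_cases h0 : a τ = 0
  · rw [h0, zero_smul]; exact zero_mem _
  · exact σ.smul_mem (ha τ) (hsupp τ h0 (hb.mem τ))

variable (hS : IsCompleteFan S) (hb : IsBarycenterChoice S b)
include hS hb

/-- After the largest multiple of `b σ` is subtracted, `b σ` is not in the minimal face of the
remainder. That face is therefore proper, and induction over the finite fan applies to it. -/
theorem exists_conicalSum_barycenter_eq (σ : S) : ∀ x ∈ σ.1, ∃ a ∈ chainCone (NonzeroCone S),
    (∀ τ, a τ ≠ 0 → τ.1 ≤ σ.1) ∧ conicalSum (fun τ : NonzeroCone S => b τ) a = x := by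
  classical
  have : Finite S := hS.finite
  induction σ using WellFoundedLT.induction with
  | ind σ ih =>
  intro x hx
  by_cases h0 : σ.1 = ⊥
  · rw [h0, Submodule.mem_bot] at hx
    exact ⟨0, zero_mem_chainCone, fun τ hτ => absurd rfl hτ, by rw [map_zero, hx]⟩
  let σ' : NonzeroCone S := ⟨σ, σ.2, h0⟩
  have hbσ : b σ ∈ σ.1 := hb.mem σ'
  have hb0 : b σ ≠ 0 := by
    intro h
    have := (hb σ σ.2 h0).1
    simp [h] at this
  obtain ⟨t, ht, hy, hmax⟩ := PointedCone.exists_maximal_sub_smul_mem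
    (PointedCone.isClosed_of_fg_of_salient (hS.polyhedral σ σ.2) (hS.stronglyConvex σ σ.2))
    (hS.stronglyConvex σ σ.2) hx hbσ hb0
  have hF := PointedCone.minimalFace_isFaceOf hy
  have hbF : b σ ∉ σ.1.minimalFace hy := fun ⟨_, ε, hε, hmem⟩ => hmax ε hε hmem
  have hlt : (⟨_, hS.face_mem σ σ.2 _ hF⟩ : S) < σ :=
    lt_of_le_of_ne hF.le fun h =>
      hbF ((congr_arg Subtype.val h : σ.1.minimalFace hy = σ.1).ge hbσ)
  obtain ⟨a, ha, hsupp, hsum⟩ := ih _ hlt _ (PointedCone.self_mem_minimalFace hy)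
  have hsingle : ∀ τ, (Pi.single σ' t : NonzeroCone S → ℝ) τ ≠ 0 → τ = σ' := by
    intro τ hτ
    by_contra h
    simp [h] at hτ
  have hle (τ : NonzeroCone S) (hτ : a τ ≠ 0) : τ.1 ≤ σ.1 := (hsupp τ hτ).trans hF.le
  refine ⟨a + Pi.single σ' t, add_mem_chainCone ha (single_mem_chainCone σ' ht)
    fun τ τ' hτ hτ' => Or.inl (hsingle τ' hτ' ▸ hle τ hτ), fun τ hτ => ?_, ?_⟩
  · by_cases h : τ = σ'
    · rw [h]
    · refine hle τ ?_
      rwa [Pi.add_apply, Pi.single_eq_of_ne h, add_zero] at hτ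
  · rw [map_add, hsum, conicalSum_single, sub_add_cancel]

/-- A conical combination of barycenters of proper faces of `σ` is on the boundary of `σ`. -/
theorem conicalSum_barycenter_sub_notMem {σ : NonzeroCone S} {a : NonzeroCone S → ℝ}
    (ha : a ∈ chainCone (NonzeroCone S)) (hsupp : ∀ τ, a τ ≠ 0 → τ < σ) {ε : ℝ} (hε : 0 < ε) :
    conicalSum (fun τ : NonzeroCone S => b τ) a - ε • b σ ∉ σ.1 := by
  intro hmem
  -- The face is the largest cone in the support, or `⊥` if the support is empty.
  have key : ∃ F : PointedCone ℝ (EuclideanSpace ℝ (Fin n)), F.IsFaceOf σ.1 ∧ F ≠ σ.1 ∧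
      conicalSum (fun τ : NonzeroCone S => b τ) a ∈ F := by
    rcases (Function.support a).eq_empty_or_nonempty with h0 | hne
    · refine ⟨⊥, hS.isFaceOf σ.2.1 hS.bot_mem bot_le, σ.2.2.symm, ?_⟩
      rw [Function.support_eq_empty_iff.1 h0, map_zero]
      exact zero_mem _
    · obtain ⟨ρ, hρ⟩ := (toFinite (Function.support a)).exists_maximal hne
      have hρσ := hsupp ρ hρ.1
      refine ⟨ρ.1, hS.isFaceOf σ.2.1 ρ.2.1 hρσ.le, fun h => hρσ.ne (Subtype.ext h),
        conicalSum_barycenter_mem hb ha.1 fun τ hτ => ?_⟩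
      rcases (mem_chainCone_iff.1 ha).2 τ ρ hτ hρ.1 with h | h
      · exact h
      · exact hρ.2 hτ h
  obtain ⟨F, hF, hne, hFmem⟩ := key
  refine hne (hb.eq_of_isFaceOf σ hF (hF.mem_of_smul_add_mem (hb.mem σ) hmem hε ?_))
  rwa [add_sub_cancel]

/-- If `c σ` were larger, removing the terms at `σ` would show that a positive multiple of `b σ` can
be subtracted from a boundary point without leaving `σ`. -/
theorem coeff_le_of_conicalSum_barycenter_eq {σ : NonzeroCone S} {a c : NonzeroCone S → ℝ}
    (ha : a ∈ chainCone (NonzeroCone S)) (hc : c ∈ chainCone (NonzeroCone S))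
    (hasupp : ∀ τ, a τ ≠ 0 → τ ≤ σ) (hcsupp : ∀ τ, c τ ≠ 0 → τ ≤ σ)
    (heq : conicalSum (fun τ : NonzeroCone S => b τ) a =
      conicalSum (fun τ : NonzeroCone S => b τ) c) : c σ ≤ a σ := by
  classical
  by_contra! hlt
  have hupd : ∀ {a : NonzeroCone S → ℝ} {τ}, Function.update a σ 0 τ ≠ 0 → τ ≠ σ ∧ a τ ≠ 0 := by
    intro a τ hτ
    by_cases h : τ = σ
    · subst h; simp at hτ
    · exact ⟨h, by simpa [h] using hτ⟩
  have hnonneg {a : NonzeroCone S → ℝ} (ha : ∀ τ, 0 ≤ a τ) (τ) : 0 ≤ Function.update a σ 0 τ := by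
    by_cases h : τ = σ
    · subst h; simp
    · simpa [h] using ha τ
  refine conicalSum_barycenter_sub_notMem hS hb (σ := σ) (a := Function.update a σ 0)
    (mem_chainCone_iff.2 ⟨hnonneg ha.1, fun τ ρ hτ hρ =>
      (mem_chainCone_iff.1 ha).2 τ ρ (hupd hτ).2 (hupd hρ).2⟩)
    (fun τ hτ => lt_of_le_of_ne (hasupp τ (hupd hτ).2) (hupd hτ).1) (sub_pos.2 hlt) ?_
  have h1 := conicalSum_barycenter_mem hb (σ := σ.1) (hnonneg hc.1)
    fun τ hτ => hcsupp τ (hupd hτ).2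
  rw [conicalSum_update] at h1 ⊢
  rw [heq]
  convert h1 using 1
  module

/-- The common value lies in the face `σ ⊓ σ'` of `σ` and has a positive multiple of `b σ` as a
summand. So `b σ`, a relative interior point, lies in that face, which must be all of `σ`. -/
theorem le_of_conicalSum_barycenter_eq {σ σ' : NonzeroCone S} {a c : NonzeroCone S → ℝ}
    (ha : a ∈ chainCone (NonzeroCone S)) (hc : c ∈ chainCone (NonzeroCone S)) (hσ : a σ ≠ 0)
    (hasupp : ∀ τ, a τ ≠ 0 → τ ≤ σ) (hcsupp : ∀ τ, c τ ≠ 0 → τ ≤ σ')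
    (heq : conicalSum (fun τ : NonzeroCone S => b τ) a =
      conicalSum (fun τ : NonzeroCone S => b τ) c) : σ ≤ σ' := by
  classical
  have h1 := conicalSum_barycenter_mem hb (σ := σ.1) ha.1 hasupp
  have h2 := conicalSum_barycenter_mem hb (σ := σ'.1) hc.1 hcsupp
  rw [← heq] at h2
  have h3 : conicalSum (fun τ : NonzeroCone S => b τ) (Function.update a σ 0) ∈ σ.1 := by
    refine conicalSum_barycenter_mem hb (fun τ => ?_) fun τ hτ => ?_
    · by_cases h : τ = σ
      · subst h; simp
      · simpa [h] using ha.1 τ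
    · by_cases h : τ = σ
      · exact h.le
      · exact hasupp τ (by simpa [h] using hτ)
  have hF := (hS.inter_isFace σ.1 σ.2.1 σ'.1 σ'.2.1).1
  have h4 : b σ ∈ σ.1 ⊓ σ'.1 := by
    refine hF.mem_of_smul_add_mem (hb.mem σ) h3 (lt_of_le_of_ne (ha.1 σ) hσ.symm) ?_
    rw [conicalSum_update, add_sub_cancel]
    exact ⟨h1, h2⟩
  exact inf_eq_left.1 (hb.eq_of_isFaceOf σ hF h4)

/-- Equal sums have the same top cone with the same coefficient; this term is removed and the
argument repeated on a smaller support. -/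
theorem injOn_conicalSum_barycenter :
    InjOn (conicalSum fun τ : NonzeroCone S => b τ) (chainCone (NonzeroCone S)) := by
  classical
  have hmax {a : NonzeroCone S → ℝ} (ha : a ∈ chainCone (NonzeroCone S)) (h0 : a ≠ 0) :
      ∃ σ, a σ ≠ 0 ∧ ∀ τ, a τ ≠ 0 → τ ≤ σ := by
    obtain ⟨ρ, hρ⟩ := (toFinite (Function.support a)).exists_maximal
      (Function.support_nonempty_iff.2 h0)
    refine ⟨ρ, hρ.1, fun τ hτ => ?_⟩
    rcases (mem_chainCone_iff.1 ha).2 τ ρ hτ hρ.1 with h | h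
    · exact h
    · exact hρ.2 hτ h
  have hcommon {a c : NonzeroCone S → ℝ} (ha : a ∈ chainCone (NonzeroCone S))
      (hc : c ∈ chainCone (NonzeroCone S)) (heq : conicalSum (fun τ : NonzeroCone S => b τ) a =
        conicalSum (fun τ : NonzeroCone S => b τ) c) (h0 : a ≠ 0) :
      ∃ σ, a σ ≠ 0 ∧ (∀ τ, a τ ≠ 0 → τ ≤ σ) ∧ ∀ τ, c τ ≠ 0 → τ ≤ σ := by
    obtain ⟨σ, hσ, hle⟩ := hmax ha h0
    refine ⟨σ, hσ, hle, ?_⟩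
    by_cases hc0 : c = 0
    · simp [hc0]
    · obtain ⟨σ', hσ', hle'⟩ := hmax hc hc0
      have := le_of_conicalSum_barycenter_eq hS hb hc ha hσ' hle' hle heq.symm
      exact fun τ hτ => (hle' τ hτ).trans this
  have hupdate {a : NonzeroCone S → ℝ} (ha : a ∈ chainCone (NonzeroCone S)) (σ) :
      Function.update a σ 0 ∈ chainCone (NonzeroCone S) := by
    have hupd : ∀ {τ}, Function.update a σ 0 τ ≠ 0 → a τ ≠ 0 := by
      intro τ hτ
      by_cases h : τ = σ
      · subst h; simp at hτ
      · simpa [h] using hτ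
    refine mem_chainCone_iff.2 ⟨fun τ => ?_, fun τ ρ hτ hρ =>
      (mem_chainCone_iff.1 ha).2 τ ρ (hupd hτ) (hupd hρ)⟩
    by_cases h : τ = σ
    · subst h; simp
    · simpa [h] using ha.1 τ
  suffices ∀ (N : ℕ) (a c : NonzeroCone S → ℝ), (Function.support a).ncard = N →
      a ∈ chainCone (NonzeroCone S) → c ∈ chainCone (NonzeroCone S) →
      conicalSum (fun τ : NonzeroCone S => b τ) a =
        conicalSum (fun τ : NonzeroCone S => b τ) c → a = c from
    fun a ha c hc heq => this _ a c rfl ha hc heq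
  intro N
  induction N using Nat.strong_induction_on with
  | h N ih =>
  intro a c hN ha hc heq
  by_cases h0 : a = 0 ∧ c = 0
  · rw [h0.1, h0.2]
  obtain ⟨σ, hσ, hale, hcle⟩ : ∃ σ, (a σ ≠ 0 ∨ c σ ≠ 0) ∧ (∀ τ, a τ ≠ 0 → τ ≤ σ) ∧
      ∀ τ, c τ ≠ 0 → τ ≤ σ := by
    by_cases ha0 : a = 0
    · obtain ⟨σ, h1, h2, h3⟩ := hcommon hc ha heq.symm fun hc0 => h0 ⟨ha0, hc0⟩
      exact ⟨σ, Or.inr h1, h3, h2⟩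
    · obtain ⟨σ, h1, h2, h3⟩ := hcommon ha hc heq ha0
      exact ⟨σ, Or.inl h1, h2, h3⟩
  have hac : a σ = c σ := le_antisymm
    (coeff_le_of_conicalSum_barycenter_eq hS hb hc ha hcle hale heq.symm)
    (coeff_le_of_conicalSum_barycenter_eq hS hb ha hc hale hcle heq)
  have hσa : a σ ≠ 0 := by
    rcases hσ with h | h
    · exact h
    · rwa [hac]
  have hlt : (Function.support (Function.update a σ 0)).ncard < N := by
    rw [← hN]
    refine ncard_lt_ncard ⟨fun τ hτ => ?_, fun h => ?_⟩ (toFinite _)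
    · by_cases h : τ = σ
      · rw [h]; exact hσa
      · simpa [h] using hτ
    · simpa using h (show σ ∈ Function.support a from hσa)
  have h1 := ih _ hlt (Function.update a σ 0) (Function.update c σ 0) rfl (hupdate ha σ)
    (hupdate hc σ) (by rw [conicalSum_update, conicalSum_update, heq, hac])
  ext τ
  by_cases h : τ = σ
  · rw [h, hac]
  · simpa [h] using congr_fun h1 τ

theorem coneSpan_barycenter (σ : NonzeroCone S) :
    coneSpan (fun τ : NonzeroCone S => b τ) σ =
      Submodule.span ℝ (σ.1 : Set (EuclideanSpace ℝ (Fin n))) := by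
  apply le_antisymm
  · refine Submodule.span_mono ?_
    rintro _ ⟨τ, hτ, rfl⟩
    exact (show τ.1 ≤ σ.1 from hτ) (hb.mem τ)
  · refine Submodule.span_le.2 fun x hx => ?_
    obtain ⟨a, -, hsupp, rfl⟩ := exists_conicalSum_barycenter_eq hS hb ⟨σ, σ.2.1⟩ x hx
    exact conicalSum_mem_span _ hsupp

theorem isConicalTriangulation_barycenter :
    IsConicalTriangulation (fun τ : NonzeroCone S => b τ) := by
  refine ⟨⟨mapsTo_univ _ _, injOn_conicalSum_barycenter hS hb, fun x _ => ?_⟩, fun σ w hw => ?_⟩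
  · obtain ⟨σ, hσ, hx⟩ := hS.complete x
    obtain ⟨a, ha, -, h⟩ := exists_conicalSum_barycenter_eq hS hb ⟨σ, hσ⟩ x hx
    exact ⟨a, ha, h⟩
  · rw [coneSpan_barycenter hS hb] at hw
    obtain ⟨ε, hε, hmem⟩ := PointedCone.exists_add_smul_mem_of_mem_intrinsicInterior
      (hb σ σ.2.1 σ.2.2).2 hw
    have h1 := σ.1.smul_mem (inv_nonneg.2 hε.le) hmem
    rw [smul_add, inv_smul_smul₀ hε.ne'] at h1
    -- Scaling `b σ + ε • w ∈ σ` by `ε⁻¹` yields the absorbing multiple.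
    exact ⟨ε⁻¹, inv_nonneg.2 hε.le, exists_conicalSum_barycenter_eq hS hb ⟨σ, σ.2.1⟩ _ h1⟩

/-- A flag of cones containing `σ` has only dimensions at least that of `σ`. Conversely, the support
of a point is itself a flag, and a cone of the right dimension is found inside its smallest member.
-/
theorem ballFiltration_eq_dualFiltration :
    ballFiltration S b = dualFiltration (fun τ : NonzeroCone S => b τ) := by
  classical
  have hT := isConicalTriangulation_barycenter hS hb
  have hdim (σ : NonzeroCone S) :
      Module.finrank ℝ (coneSpan (fun τ : NonzeroCone S => b τ) σ) = coneDim σ.1 := by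
    rw [coneSpan_barycenter hS hb]; rfl
  have hbot : coneDim (⊥ : PointedCone ℝ (EuclideanSpace ℝ (Fin n))) = 0 := by
    simp [coneDim]
  ext i x
  constructor
  · rintro ⟨σ, hσ, hi, hx⟩
    by_cases h0 : σ = ⊥
    · subst h0
      exact Or.inl (by rw [hbot] at hi; omega)
    · rw [sphericalDual, if_neg h0] at hx
      obtain ⟨_, ⟨c, ⟨hne, hcS, hcbot, hchain⟩, hle, rfl⟩, hx1, hx2⟩ := hx
      have hpos := hT.finrank_coneSpan_pos ⟨σ, hσ, h0⟩
      rw [hdim] at hpos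
      dsimp only at hpos
      refine Or.inr ⟨by omega, by simpa using hx1, ?_⟩
      let Q : Set (NonzeroCone S) := {τ | τ.1 ∈ c}
      have hQ : b '' c = range fun τ : Q => b τ.1 := by
        ext y
        constructor
        · rintro ⟨τ, hτ, rfl⟩
          exact ⟨⟨⟨τ, hcS hτ, fun h => hcbot (h ▸ hτ)⟩, hτ⟩, rfl⟩
        · rintro ⟨τ, rfl⟩
          exact ⟨_, τ.2, rfl⟩
      rw [hQ] at hx2
      obtain ⟨a, ha, hsum⟩ := PointedCone.mem_hull_range_iff.1 hx2
      have haQ : a ∈ chainCone Q :=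
        mem_chainCone_iff.2 ⟨ha, fun τ ρ _ _ => hchain.total τ.2 ρ.2⟩
      have h1 := chainCoord_eq hT.bijOn (extendZero_mem_chainCone haQ)
        ((conicalSum_comp_val Q (fun τ : NonzeroCone S => b τ) a).symm.trans hsum)
      intro τ hτ
      rw [h1] at hτ
      have h2 : σ ≤ τ.1 := hle _ (mem_of_extendZero_ne_zero hτ : τ ∈ Q)
      have h3 := Submodule.finrank_mono
        (coneSpan_mono (b := fun τ : NonzeroCone S => b τ) (σ := τ) (τ := ⟨σ, hσ, h0⟩) h2)
      rw [hdim] at h3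
      dsimp only at h3
      omega
  · rintro (rfl | ⟨hi, hx1, hx2⟩)
    · refine ⟨⊥, hS.bot_mem, by rw [hbot]; simp, ?_⟩
      rw [sphericalDual, if_pos rfl]
      exact x.2
    · have hx0 : (x : EuclideanSpace ℝ (Fin n)) ≠ 0 := fun h => by simp [h] at hx1
      obtain ⟨τ, hτ⟩ := exists_chainCoord_ne_zero hT.bijOn hx0
      obtain ⟨ρ, hρ⟩ := (toFinite (Function.support
        (chainCoord (fun τ : NonzeroCone S => b τ) x))).exists_minimal ⟨τ, hτ⟩
      obtain ⟨l, hl⟩ : ∃ l : ℕ, (n : ℤ) - l = i := by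
        have h1 := hx2 ρ hρ.1
        have h2 := (coneSpan (fun τ : NonzeroCone S => b τ) ρ).finrank_le
        rw [finrank_euclideanSpace_fin] at h2
        exact ⟨(n - i).toNat, by omega⟩
      have h1 := hx2 ρ hρ.1
      -- The smallest cone `ρ` of the support may have dimension above `n - i`; a smaller cone of
      -- dimension exactly `n - i` is needed.
      obtain ⟨σ, hσρ, hσ⟩ := hT.exists_le_finrank_coneSpan_eq ρ (l := l) (by omega) (by omega)
      rw [hdim] at hσ
      refine ⟨σ, σ.2.1, by rw [hσ]; exact hl, ?_⟩
      rw [sphericalDual, if_neg σ.2.2]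
      have hchain := (chainCoord_mem hT.bijOn (x : EuclideanSpace ℝ (Fin n))).2
      refine mem_sUnion.2 ⟨_, ⟨Subtype.val '' Function.support
        (chainCoord (fun τ : NonzeroCone S => b τ) x), ⟨⟨_, τ, hτ, rfl⟩, ?_, ?_, ?_⟩, ?_, rfl⟩,
        ?_, ?_⟩
      · rintro _ ⟨τ, -, rfl⟩
        exact τ.2.1
      · rintro ⟨τ, -, h⟩
        exact τ.2.2 h
      · rintro _ ⟨τ, hτ, rfl⟩ _ ⟨τ', hτ', rfl⟩ hne
        exact hchain hτ hτ' fun h => hne (congr_arg _ h)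
      · rintro _ ⟨τ, hτ, rfl⟩
        refine (show σ ≤ τ from hσρ.trans ?_)
        rcases chainCoord_total hT.bijOn _ hρ.1 hτ with h | h
        · exact h
        · exact hρ.2 hτ h
      · simpa using hx1
      · refine (conicalSum_chainCoord hT.bijOn (x : EuclideanSpace ℝ (Fin n))).subst
          (motive := fun y => y ∈ PointedCone.hull ℝ (b '' (Subtype.val '' Function.support
            (chainCoord (fun τ : NonzeroCone S => b τ) x)))) ?_
        rw [Fintype.linearCombination_apply]
        refine sum_mem fun τ _ => ?_
        by_cases h0 : chainCoord (fun τ : NonzeroCone S => b τ) x τ = 0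
        · rw [h0, zero_smul]; exact zero_mem _
        · exact PointedCone.smul_mem _ (chainCoord_nonneg hT.bijOn _ _)
            (Submodule.subset_span ⟨τ, ⟨τ, h0, rfl⟩, rfl⟩)

end Fan

theorem mainTheorem9 (n : ℕ) (S : Set (PointedCone ℝ (EuclideanSpace ℝ (Fin n))))
    (hS : IsCompleteFan S)
    (b : PointedCone ℝ (EuclideanSpace ℝ (Fin n)) → EuclideanSpace ℝ (Fin n))
    (hb : IsBarycenterChoice S b) :
    IsTopologicalStratifiedPseudomanifold n
      (Metric.closedBall (0 : EuclideanSpace ℝ (Fin n)) 1) (ballFiltration S b) := by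
  have : Finite (NonzeroCone S) := hS.finite.subset fun _ h => h.1
  have := Fintype.ofFinite (NonzeroCone S)
  rw [ballFiltration_eq_dualFiltration hS hb]
  exact (isConicalTriangulation_barycenter hS hb).isTopologicalStratifiedPseudomanifold n
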